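/- Let $n>1$, write $z_j=x_j+iy_j$ for the coordinates on $\mathbb C^n$, and let $M=\{z\in\mathbb C^n:\rho(z)=0\}$ be a real quadratic cone with defining function $\rho$; that is, $\rho$ is a real-valued homogeneous polynomial of degree two in the $x_j,y_j$, the set $M$ is an irreducible real algebraic set of pure dimension $2n-1$, and $d\rho(z)\neq 0$ for some $z\in M$. Let $\Omega$ be an open neighbourhood of $0$ in $\mathbb C^n$ and put $\Omega^{\pm}=\{z\in\Omega:\pm\rho(z)>0\}$. We say that $M$ has two-sided support by complex hypersurfaces at the origin if there are germs at $0$ of complex analytic hypersurfaces $A^+$ and $A^-$ such that $A^{+}\subset\overline{\Omega^{+}}$ and $A^{-}\subset\overline{\Omega^{-}}$ as germs at $0$. Then the following are equivalent. (a) $M$ does not have two-sided support by complex hypersurfaces at the origin. (b) There is an open neighbourhood $U$ of the origin such that either for every $f$ holomorphic on $\Omega^+$ there is $F$ holomorphic on $U$ with $F=f$ on $U\cap\Omega^+$, or for every $f$ holomorphic on $\Omega^-$ there is $F$ holomorphic on $U$ with $F=f$ on $U\cap\Omega^-$. -/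

import Mathlib

open scoped Topology

noncomputable section

namespace QuadCone

/-- The space `ℂⁿ`. -/
abbrev Cn (n : ℕ) : Type := EuclideanSpace ℂ (Fin n)

/-- The real coordinates `(x₁, …, xₙ, y₁, …, yₙ)` of `z`, where `zⱼ = xⱼ + i yⱼ`. -/
def realCoords {n : ℕ} (z : Cn n) : Fin n ⊕ Fin n → ℝ :=
  Sum.elim (fun j => (z j).re) (fun j => (z j).im)

/-- Real polynomials in the `2n` real coordinates of `ℂⁿ`; the left summand indexes the `xⱼ`, the
right summand the `yⱼ`. -/
abbrev RealPoly (n : ℕ) : Type := MvPolynomial (Fin n ⊕ Fin n) ℝ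

/-- The real-valued function on `ℂⁿ` given by a real polynomial in the `xⱼ` and `yⱼ`. -/
def polyFun {n : ℕ} (P : RealPoly n) (z : Cn n) : ℝ :=
  MvPolynomial.eval (realCoords z) P

/-- The zero set `{ρ = 0}` in `ℂⁿ`. -/
def zeroLocus {n : ℕ} (ρ : RealPoly n) : Set (Cn n) := {z | polyFun ρ z = 0}

/-- Real algebraic subsets of `ℂⁿ = ℝ²ⁿ`: common zero sets of families of real polynomials. -/
def IsRealAlgebraic {n : ℕ} (A : Set (Cn n)) : Prop :=
  ∃ S : Set (RealPoly n), A = {z | ∀ P ∈ S, polyFun P z = 0}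

/-- `M` is an irreducible real algebraic set: it is non-empty and not the union of two proper real
algebraic subsets. -/
def IsIrreducibleRealAlgebraic {n : ℕ} (M : Set (Cn n)) : Prop :=
  IsRealAlgebraic M ∧ M.Nonempty ∧
    ∀ A B : Set (Cn n), IsRealAlgebraic A → IsRealAlgebraic B → M = A ∪ B → M = A ∨ M = B

/-- `M = {ρ = 0}` is a real quadratic cone in `ℂⁿ` with defining function `ρ`: `ρ` is a real
homogeneous polynomial of degree two in the `xⱼ`, `yⱼ`, its zero set is irreducible, and the
differential of `ρ` is non-zero at some point of `M`.

The last condition makes `ρ` indefinite as a real quadratic form, and then `M`, being up to a linear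
change of real coordinates the set `∑_{i ≤ p} tᵢ² = ∑_{p < i ≤ p + q} tᵢ²` with `p, q ≥ 1`, is
automatically of pure real dimension `2n - 1`; so this needs no separate clause. -/
structure IsQuadraticCone {n : ℕ} (ρ : RealPoly n) : Prop where
  homogeneous : ρ.IsHomogeneous 2
  irreducible_zeroLocus : IsIrreducibleRealAlgebraic (zeroLocus ρ)
  differential_ne_zero : ∃ z ∈ zeroLocus ρ, ∃ i : Fin n ⊕ Fin n,
    polyFun (MvPolynomial.pderiv i ρ) z ≠ 0

/-- `Ω⁺ = {z ∈ Ω : ρ(z) > 0}`. -/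
def posSide {n : ℕ} (ρ : Cn n → ℝ) (Ω : Set (Cn n)) : Set (Cn n) := {z | z ∈ Ω ∧ 0 < ρ z}

/-- `Ω⁻ = {z ∈ Ω : ρ(z) < 0}`. -/
def negSide {n : ℕ} (ρ : Cn n → ℝ) (Ω : Set (Cn n)) : Set (Cn n) := {z | z ∈ Ω ∧ ρ z < 0}

/-- The set `A` represents a germ at `p` of a complex analytic hypersurface: near `p` it is the zero
set of a holomorphic function which vanishes at `p` and does not vanish identically near `p`. -/
def IsComplexHypersurfaceAt {n : ℕ} (A : Set (Cn n)) (p : Cn n) : Prop :=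
  ∃ V : Set (Cn n), IsOpen V ∧ p ∈ V ∧ ∃ φ : Cn n → ℂ, DifferentiableOn ℂ φ V ∧
    φ p = 0 ∧ (¬ ∀ᶠ z in 𝓝 p, φ z = 0) ∧ A ∩ V = {z | z ∈ V ∧ φ z = 0}

/-- Inclusion `A ⊆ B` of germs of sets at `p`. -/
def GermSubset {n : ℕ} (p : Cn n) (A B : Set (Cn n)) : Prop :=
  ∀ᶠ z in 𝓝 p, z ∈ A → z ∈ B

/-- Two-sided support by complex hypersurfaces at `p` of the hypersurface with defining function `ρ`
in the neighbourhood `Ω` of `p`: there are germs at `p` of complex analytic hypersurfaces `A⁺`, `A⁻`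
with `A⁺` in the closure of `Ω⁺` and `A⁻` in the closure of `Ω⁻`. -/
def HasTwoSidedSupport {n : ℕ} (ρ : Cn n → ℝ) (Ω : Set (Cn n)) (p : Cn n) : Prop :=
  ∃ Aplus Aminus : Set (Cn n),
    IsComplexHypersurfaceAt Aplus p ∧ IsComplexHypersurfaceAt Aminus p ∧
    GermSubset p Aplus (closure (posSide ρ Ω)) ∧ GermSubset p Aminus (closure (negSide ρ Ω))

/-- Every function holomorphic on the open set `D` extends holomorphically to `U`: there is a
holomorphic function on `U` which agrees with it on `U ∩ D`. -/
def AllExtendTo {n : ℕ} (D U : Set (Cn n)) : Prop :=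
  ∀ f : Cn n → ℂ, DifferentiableOn ℂ f D →
    ∃ F : Cn n → ℂ, DifferentiableOn ℂ F U ∧ Set.EqOn F f (U ∩ D)

end QuadCone

end

/-! Write `ρ z = B z z` with `B` real, symmetric and, since `dρ ≠ 0` somewhere on the cone,
indefinite. The equivalence splits into one statement per side: holomorphic functions on `{B < 0}`
extend across the origin exactly when no germ of a complex hypersurface at the origin lies in `{B ≥
0}`. The theorem is this statement for `B` and for `-B`.

A hypersurface obstructs extension: the initial form of its defining germ is an entire function `Φ`
with `Φ 0 = 0`, and by a Hurwitz argument together with the homogeneity of `ρ` it has no zeros in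
`{B < 0}` (`exists_entire_ne_zero`). Then `1 / Φ` does not extend (`not_forall_extends`).

Conversely (`exists_extension_neg`), split `B z z = H z + Re q(z, z)` with `H` Hermitian and `q`
complex bilinear. If no hypersurface lies in `{B ≥ 0}`, the quadric `q(z, z) = 0` does not, so there
is `v` with `B (ζ v) (ζ v) = -|ζ|²`. Completing the square gives `B (z + ζ v) (z + ζ v) = S z z - |c
z - ζ|²`, and three cases remain. If `S w w < 0` for some `w`, discs parallel to `v` give a Hartogs
extension. If `S ≥ 0` and every complex plane containing `v` has a line transverse to `v` in `{B ≥
0}`, a Hahn-Banach argument (`exists_complexLinear_near`) assembles a complex hyperplane in `{B ≥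
0}`, which is excluded. Otherwise some plane has coordinates with `q = ζ η` and `B < 0` wherever `ζ
η` is a negative real; annuli on the curves `ζ η = t`, degenerating to two crossing discs, then give
the extension (`exists_extension_of_hyperbolas`). Connectedness of the negative side
(`isPreconnected_inter_neg`) turns agreement near one point into agreement everywhere. -/

noncomputable section

namespace QuadCone

/-! ### Holomorphy in several variables: continuity of the derivative, parameter integrals, the
identity theorem. -/

section SeveralVariables

variable {E : Type*} [NormedAddCommGroup E] [NormedSpace ℂ E]

theorem differentiableOn_comp_line {f : E → ℂ} {s : Set E} (hs : IsOpen s)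
    (hf : DifferentiableOn ℂ f s) (z v : E) :
    DifferentiableOn ℂ (fun t : ℂ => f (z + t • v)) {t | z + t • v ∈ s} := by
  intro t ht
  have h1 : DifferentiableAt ℂ f (z + t • v) := hf.differentiableAt (hs.mem_nhds ht)
  have h2 : DifferentiableAt ℂ (fun t : ℂ => z + t • v) t := by fun_prop
  exact (DifferentiableAt.comp t h1 h2).differentiableWithinAt

/-- The derivative of a holomorphic function of several variables is continuous. -/
theorem continuousOn_fderiv_of_differentiableOn [FiniteDimensional ℂ E] {f : E → ℂ} {s : Set E}
    (hs : IsOpen s) (hf : DifferentiableOn ℂ f s) : ContinuousOn (fderiv ℂ f) s := by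
  have : ProperSpace E := FiniteDimensional.proper ℂ E
  intro z₀ hz₀
  refine ContinuousAt.continuousWithinAt ?_
  obtain ⟨R, hR, hRs⟩ := Metric.isOpen_iff.1 hs z₀ hz₀
  set r := R / 3 with hr
  have hr0 : 0 < r := by positivity
  have hsub : Metric.closedBall z₀ (2 * r) ⊆ s :=
    (Metric.closedBall_subset_ball (by rw [hr]; linarith)).trans hRs
  have huc : UniformContinuousOn f (Metric.closedBall z₀ (2 * r)) :=
    (isCompact_closedBall z₀ (2 * r)).uniformContinuousOn_of_continuous
      (hf.continuousOn.mono hsub)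
  rw [Metric.continuousAt_iff]
  intro ε hε
  -- The tolerance `ε / 2 * r` becomes `ε / 2 * ‖v‖` under the Cauchy estimate on the disc of radius
  -- `r / ‖v‖`, the largest one whose translates along `v` surely stay in the compact ball.
  obtain ⟨δ, hδ, hδ'⟩ := Metric.uniformContinuousOn_iff.1 huc (ε / 2 * r) (by positivity)
  refine ⟨min δ r, lt_min hδ hr0, fun z hz => ?_⟩
  have hzδ : dist z z₀ < δ := hz.trans_le (min_le_left _ _)
  have hzr : dist z z₀ < r := hz.trans_le (min_le_right _ _)
  have hin : ∀ w : E, ‖w‖ ≤ r → ∀ y : E, dist y z₀ < r → y + w ∈ Metric.closedBall z₀ (2 * r) := by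
    intro w hw y hy
    rw [Metric.mem_closedBall, dist_eq_norm]
    calc ‖y + w - z₀‖ = ‖(y - z₀) + w‖ := by congr 1; abel
      _ ≤ ‖y - z₀‖ + ‖w‖ := norm_add_le _ _
      _ ≤ 2 * r := by rw [← dist_eq_norm]; linarith
  rw [dist_eq_norm]
  refine lt_of_le_of_lt (ContinuousLinearMap.opNorm_le_bound _ (by positivity : 0 ≤ ε / 2) ?_)
    (half_lt_self hε)
  intro v
  rcases eq_or_ne v 0 with rfl | hv
  · simp
  have hv0 : 0 < ‖v‖ := norm_pos_iff.2 hv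
  have hz0r : dist z₀ z₀ < r := by simpa using hr0
  have hder : ∀ y : E, dist y z₀ < r →
      HasDerivAt (fun t : ℂ => f (y + t • v)) (fderiv ℂ f y v) 0 := by
    intro y hy
    have hys : y ∈ s := hsub (by simpa using hin 0 (by simpa using hr0.le) y hy)
    have h1 : HasFDerivAt f (fderiv ℂ f y) (y + (0 : ℂ) • v) := by
      simpa using (hf.differentiableAt (hs.mem_nhds hys)).hasFDerivAt
    have h2 : HasDerivAt (fun t : ℂ => y + t • v) v 0 := by
      simpa using ((hasDerivAt_id (0 : ℂ)).smul_const v).const_add y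
    exact h1.comp_hasDerivAt (0 : ℂ) h2
  have hmem : ∀ y : E, dist y z₀ < r → ∀ t ∈ Metric.closedBall (0 : ℂ) (r / ‖v‖),
      y + t • v ∈ Metric.closedBall z₀ (2 * r) := by
    intro y hy t ht
    refine hin _ ?_ y hy
    rw [norm_smul]
    have : ‖t‖ ≤ r / ‖v‖ := by simpa using ht
    exact (le_div_iff₀ hv0).1 this
  have hdiff : ∀ y : E, dist y z₀ < r →
      DifferentiableOn ℂ (fun t : ℂ => f (y + t • v)) (Metric.closedBall 0 (r / ‖v‖)) := fun y hy =>
    (differentiableOn_comp_line hs hf y v).mono fun t ht => hsub (hmem y hy t ht)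
  have hD : DiffContOnCl ℂ (fun t : ℂ => f (z + t • v) - f (z₀ + t • v))
      (Metric.ball 0 (r / ‖v‖)) := by
    refine DifferentiableOn.diffContOnCl ?_
    rw [closure_ball _ (by positivity)]
    exact (hdiff z hzr).sub (hdiff z₀ hz0r)
  have hb := Complex.norm_deriv_le_of_forall_mem_sphere_norm_le (c := (0 : ℂ))
    (C := ε / 2 * r) (by positivity : 0 < r / ‖v‖) hD (by
      intro t ht
      have ht' := Metric.sphere_subset_closedBall ht
      have := hδ' _ (hmem z hzr t ht') _ (hmem z₀ hz0r t ht') (by simpa using hzδ)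
      rw [dist_eq_norm] at this
      exact this.le)
  have hd : deriv (fun t : ℂ => f (z + t • v) - f (z₀ + t • v)) 0 =
      (fderiv ℂ f z - fderiv ℂ f z₀) v := by
    exact ((hder z hzr).sub (hder z₀ hz0r)).deriv
  rw [hd] at hb
  refine hb.trans (le_of_eq ?_)
  field_simp

/-- A circle integral depending holomorphically on a parameter is holomorphic. -/
theorem differentiableOn_circleIntegral [FiniteDimensional ℂ E] {G : ℂ × E → ℂ}
    {W : Set (ℂ × E)} (hW : IsOpen W) (hG : DifferentiableOn ℂ G W) {U : Set E} (hU : IsOpen U)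
    {r : ℝ} (hr : 0 ≤ r) (hUW : ∀ s ∈ Metric.sphere (0 : ℂ) r, ∀ z ∈ U, (s, z) ∈ W) :
    DifferentiableOn ℂ (fun z => ∮ s in C(0, r), G (s, z)) U := by
  have : ProperSpace E := FiniteDimensional.proper ℂ E
  intro z₀ hz₀
  refine DifferentiableAt.differentiableWithinAt ?_
  obtain ⟨R, hR, hRU⟩ := Metric.isOpen_iff.1 hU z₀ hz₀
  set K := Metric.closedBall z₀ (R / 2) with hK
  have hKU : K ⊆ U := (Metric.closedBall_subset_ball (by linarith)).trans hRU
  have hKW : ∀ θ : ℝ, ∀ z ∈ K, (circleMap 0 r θ, z) ∈ W := fun θ z hz =>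
    hUW _ (circleMap_mem_sphere 0 hr θ) z (hKU hz)
  have hcpt : IsCompact (Metric.sphere (0 : ℂ) r ×ˢ K) :=
    (isCompact_sphere _ _).prod (isCompact_closedBall _ _)
  have hsub : Metric.sphere (0 : ℂ) r ×ˢ K ⊆ W := fun p hp => hUW _ hp.1 _ (hKU hp.2)
  have hc := continuousOn_fderiv_of_differentiableOn hW hG
  obtain ⟨C, hC⟩ := hcpt.exists_bound_of_continuousOn (hc.mono hsub)
  have hGc : ∀ z ∈ K, Continuous fun θ : ℝ => G (circleMap 0 r θ, z) := fun z hz =>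
    hG.continuousOn.comp_continuous (by fun_prop) fun θ => hKW θ z hz
  have hG'c : ∀ z ∈ K, Continuous fun θ : ℝ => fderiv ℂ G (circleMap 0 r θ, z) := fun z hz =>
    hc.comp_continuous (by fun_prop) fun θ => hKW θ z hz
  have hdc : Continuous fun θ : ℝ => deriv (circleMap 0 r) θ := by
    simp only [deriv_circleMap]; fun_prop
  have hz₀K : K ∈ 𝓝 z₀ := Metric.closedBall_mem_nhds _ (by positivity)
  have key := intervalIntegral.hasFDerivAt_integral_of_dominated_of_fderiv_le
    (𝕜 := ℂ) (μ := MeasureTheory.volume) (a := 0) (b := 2 * Real.pi)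
    (F := fun z θ => deriv (circleMap 0 r) θ • G (circleMap 0 r θ, z))
    (F' := fun z θ => deriv (circleMap 0 r) θ •
      (fderiv ℂ G (circleMap 0 r θ, z)).comp (ContinuousLinearMap.inr ℂ ℂ E))
    (x₀ := z₀) (s := K) (bound := fun _ => r * (C * ‖ContinuousLinearMap.inr ℂ ℂ E‖)) hz₀K
    (Filter.eventually_of_mem hz₀K fun z hz => (hdc.smul (hGc z hz)).aestronglyMeasurable)
    ((hdc.smul (hGc z₀ (mem_of_mem_nhds hz₀K))).intervalIntegrable _ _)
    ((hdc.smul ((hG'c z₀ (mem_of_mem_nhds hz₀K)).clm_comp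
      continuous_const)).aestronglyMeasurable)
    (Filter.Eventually.of_forall fun θ _ z hz => by
      rw [norm_smul]
      have h1 : ‖deriv (circleMap 0 r) θ‖ = r := by simp [deriv_circleMap, abs_of_nonneg hr]
      rw [h1]
      refine mul_le_mul_of_nonneg_left ?_ hr
      refine (ContinuousLinearMap.opNorm_comp_le _ _).trans ?_
      exact mul_le_mul_of_nonneg_right
        (hC (circleMap 0 r θ, z) ⟨circleMap_mem_sphere 0 hr θ, hz⟩) (norm_nonneg _))
    (by simp)
    (Filter.Eventually.of_forall fun θ _ z hz => by
      have h1 : HasFDerivAt G (fderiv ℂ G (circleMap 0 r θ, z)) (circleMap 0 r θ, z) :=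
        (hG.differentiableAt (hW.mem_nhds (hKW θ z hz))).hasFDerivAt
      have h2 : HasFDerivAt (fun z : E => (circleMap 0 r θ, z)) (ContinuousLinearMap.inr ℂ ℂ E) z :=
        hasFDerivAt_prodMk_right _ _
      exact (h1.comp z h2).const_smul (deriv (circleMap 0 r) θ))
  exact key.differentiableAt

theorem isPreconnected_line_inter_ball (y v z : E) (R : ℝ) :
    IsPreconnected {t : ℂ | y + t • v ∈ Metric.ball z R} := by
  refine Convex.isPreconnected ?_
  intro a ha b hb p q hp hq hpq
  have := (convex_ball z R) ha hb hp hq hpq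
  show y + (p • a + q • b) • v ∈ Metric.ball z R
  convert this using 1
  have e : y = p • y + q • y := by rw [← add_smul, hpq, one_smul]
  simp only [add_smul, smul_add, smul_assoc]
  generalize p • a • v = P
  generalize q • b • v = Q
  nth_rewrite 1 [e]
  abel

/-- The identity theorem in several variables. -/
theorem eqOn_of_eventuallyEq {f g : E → ℂ} {D : Set E} (hD : IsOpen D) (hDc : IsPreconnected D)
    (hf : DifferentiableOn ℂ f D) (hg : DifferentiableOn ℂ g D) {z₀ : E} (hz₀ : z₀ ∈ D)
    (h : f =ᶠ[𝓝 z₀] g) : Set.EqOn f g D := by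
  have hopen : IsOpen {z | f =ᶠ[𝓝 z] g} := isOpen_setOfPred_eventually_nhds
  have hsub : D ⊆ {z | f =ᶠ[𝓝 z] g} := by
    refine hDc.subset_of_closure_inter_subset hopen ⟨z₀, hz₀, h⟩ ?_
    rintro z ⟨hz, hzD⟩
    obtain ⟨R, hR, hRD⟩ := Metric.isOpen_iff.1 hD z hzD
    obtain ⟨y, hy, hyz⟩ := Metric.mem_closure_iff.1 hz R hR
    refine Filter.eventually_of_mem (Metric.ball_mem_nhds z hR) fun x hx => ?_
    -- The complex line with `y` at `t = 0` and `x` at `t = 1` reduces the claim to the one-variable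
    -- identity theorem.
    set L := {t : ℂ | y + t • (x - y) ∈ Metric.ball z R} with hL
    have hmap : Continuous fun t : ℂ => y + t • (x - y) := by fun_prop
    have hLo : IsOpen L := Metric.isOpen_ball.preimage hmap
    have hLc : IsPreconnected L := isPreconnected_line_inter_ball y (x - y) z R
    have ha : ∀ {k : E → ℂ}, DifferentiableOn ℂ k D →
        AnalyticOnNhd ℂ (fun t : ℂ => k (y + t • (x - y))) L := fun hk =>
      ((differentiableOn_comp_line hD hk y (x - y)).mono fun t ht => hRD ht).analyticOnNhd hLo
    have h0 : (fun t : ℂ => f (y + t • (x - y))) =ᶠ[𝓝 0] fun t : ℂ => g (y + t • (x - y)) := by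
      have : Filter.Tendsto (fun t : ℂ => y + t • (x - y)) (𝓝 0) (𝓝 y) := by
        have := hmap.tendsto 0
        simpa using this
      exact this.eventually hy
    have h0L : (0 : ℂ) ∈ L := by
      show y + (0 : ℂ) • (x - y) ∈ Metric.ball z R
      simpa [dist_comm] using hyz
    have := (ha hf).eqOn_of_preconnected_of_eventuallyEq (ha hg) hLc h0L h0
      (show (1 : ℂ) ∈ L by show y + (1 : ℂ) • (x - y) ∈ Metric.ball z R; simpa using hx)
    simpa using this
  exact fun z hz => (hsub hz).eq_of_nhds

end SeveralVariables

/-! ### Cauchy's formula on an annulus and inversion in circle integrals. -/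

section CircleIntegrals

/-- Cauchy's integral formula on an annulus centred at the origin. -/
theorem circleIntegral_sub_inv_mul_annulus {r R : ℝ} (hr : 0 < r) {g : ℂ → ℂ} {O : Set ℂ}
    (hO : IsOpen O) (hg : DifferentiableOn ℂ g O)
    (hsub : ∀ s : ℂ, r ≤ ‖s‖ → ‖s‖ ≤ R → s ∈ O) {ζ : ℂ} (h1 : r < ‖ζ‖) (h2 : ‖ζ‖ < R) :
    (∮ s in C(0, R), (s - ζ)⁻¹ * g s) - (∮ s in C(0, r), (s - ζ)⁻¹ * g s) =
      2 * Real.pi * Complex.I * g ζ := by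
  have hR : 0 < R := hr.trans (h1.trans h2)
  have hζO : O ∈ 𝓝 ζ := hO.mem_nhds (hsub ζ h1.le h2.le)
  have hd : DifferentiableOn ℂ (dslope g ζ) O := (Complex.differentiableOn_dslope hζO).2 hg
  -- The difference quotient is holomorphic across `ζ`, so both circles give the same integral; its
  -- constant term `g ζ` contributes `2πi g ζ` on the outer circle and nothing on the inner one.
  have heq : (∮ s in C(0, R), dslope g ζ s) = ∮ s in C(0, r), dslope g ζ s := by
    refine Complex.circleIntegral_eq_of_differentiable_on_annulus_off_countable hr
      (h1.trans h2).le Set.countable_empty (hd.continuousOn.mono ?_) ?_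
    · rintro s ⟨hs1, hs2⟩
      exact hsub s (by simpa using hs2) (by simpa using hs1)
    · rintro s ⟨⟨hs1, hs2⟩, -⟩
      refine hd.differentiableAt (hO.mem_nhds (hsub s ?_ ?_))
      · simp only [Metric.mem_closedBall, dist_zero_right, not_le] at hs2; exact hs2.le
      · simp only [Metric.mem_ball, dist_zero_right] at hs1; exact hs1.le
  have hexp : ∀ q : ℝ, 0 < q → r ≤ q → q ≤ R → q ≠ ‖ζ‖ →
      (∮ s in C(0, q), dslope g ζ s) =
        (∮ s in C(0, q), (s - ζ)⁻¹ * g s) - (∮ s in C(0, q), (s - ζ)⁻¹ * g ζ) := by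
    intro q hq hrq hqR hne
    have hmem : ∀ s ∈ Metric.sphere (0 : ℂ) q, s ∈ O := by
      intro s hs
      have : ‖s‖ = q := by simpa using hs
      exact hsub s (by rw [this]; exact hrq) (by rw [this]; exact hqR)
    have hnez : ∀ s ∈ Metric.sphere (0 : ℂ) q, s - ζ ≠ 0 := by
      intro s hs h0
      have : ‖s‖ = q := by simpa using hs
      rw [sub_eq_zero.1 h0] at this
      exact hne this.symm
    have hc : ContinuousOn (fun s : ℂ => (s - ζ)⁻¹) (Metric.sphere (0 : ℂ) q) :=
      ContinuousOn.inv₀ (by fun_prop) hnez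
    rw [← circleIntegral.integral_sub]
    · refine circleIntegral.integral_congr hq.le fun s hs => ?_
      have : s ≠ ζ := fun h => hnez s hs (sub_eq_zero.2 h)
      rw [dslope_of_ne _ this, slope_def_field]
      field_simp
    · exact (hc.mul (hg.continuousOn.mono hmem)).circleIntegrable hq.le
    · exact (hc.mul continuousOn_const).circleIntegrable hq.le
  rw [hexp R hR (h1.trans h2).le le_rfl h2.ne', hexp r hr le_rfl (h1.trans h2).le h1.ne] at heq
  have e1 : (∮ s in C(0, R), (s - ζ)⁻¹ * g ζ) = 2 * Real.pi * Complex.I * g ζ := by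
    have := (differentiableOn_const (s := Metric.closedBall (0 : ℂ) R)
      (g ζ)).circleIntegral_sub_inv_smul (by simpa using h2 : ζ ∈ Metric.ball (0 : ℂ) R)
    simpa only [smul_eq_mul] using this
  have e2 : (∮ s in C(0, r), (s - ζ)⁻¹ * g ζ) = 0 := by
    refine DiffContOnCl.circleIntegral_eq_zero hr.le (DifferentiableOn.diffContOnCl ?_)
    rw [closure_ball _ hr.ne']
    intro s hs
    have hs' : ‖s‖ ≤ r := by simpa using hs
    have : s - ζ ≠ 0 := fun h => by
      rw [sub_eq_zero.1 h] at hs'; exact absurd hs' (not_le.2 h1)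
    exact ((by fun_prop : DifferentiableAt ℂ (fun s : ℂ => s - ζ) s).inv this).mul_const _
      |>.differentiableWithinAt
  rw [e1, e2] at heq
  linear_combination heq

/-- The substitution `s ↦ t / s` in a circle integral. -/
theorem circleIntegral_div {t : ℂ} {r : ℝ} (hr : 0 < r) (h : ℂ → ℂ) :
    (∮ s in C(0, ‖t‖ / r), h s) = ∮ s in C(0, r), t / s ^ 2 * h (t / s) := by
  set k : ℝ → ℂ := fun θ => deriv (circleMap 0 (‖t‖ / r)) θ • h (circleMap 0 (‖t‖ / r) θ) with hk
  have hper : Function.Periodic k (2 * Real.pi) := by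
    intro θ
    simp only [hk, deriv_circleMap, periodic_circleMap 0 (‖t‖ / r) θ]
  have hmap : ∀ θ : ℝ, t / circleMap 0 r θ = circleMap 0 (‖t‖ / r) (t.arg - θ) := by
    intro θ
    have hr' : (r : ℂ) ≠ 0 := by exact_mod_cast hr.ne'
    simp only [circleMap, zero_add]
    conv_lhs => rw [← Complex.norm_mul_exp_arg_mul_I t]
    rw [div_eq_iff (mul_ne_zero hr' (Complex.exp_ne_zero _))]
    push_cast
    rw [show ((t.arg : ℂ) - θ) * Complex.I = t.arg * Complex.I - θ * Complex.I by ring,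
      Complex.exp_sub]
    have := Complex.exp_ne_zero (θ * Complex.I)
    field_simp
  have hR : (∮ s in C(0, r), t / s ^ 2 * h (t / s)) = ∫ θ in (0 : ℝ)..2 * Real.pi, k (t.arg - θ) := by
    unfold circleIntegral
    refine intervalIntegral.integral_congr fun θ _ => ?_
    have h0 : circleMap 0 r θ ≠ 0 := by
      have := circleMap_mem_sphere (0 : ℂ) hr.le θ
      intro h
      rw [h] at this
      simp at this
      exact hr.ne this
    simp only [hk, deriv_circleMap, ← hmap, smul_eq_mul]
    field_simp
  -- The map `θ ↦ arg t - θ` reverses orientation, which absorbs the sign in `d(t / s) = -t / s²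
  -- ds`; periodicity removes the shift by `arg t`.
  rw [hR, intervalIntegral.integral_comp_sub_left]
  have := hper.intervalIntegral_add_eq (t.arg - 2 * Real.pi) 0
  simp only [sub_add_cancel, zero_add] at this
  rw [sub_zero, this]
  rfl

end CircleIntegrals

/-! ### Hartogs extension along discs and along degenerating annuli. -/

section Extension

variable {E : Type*} [NormedAddCommGroup E] [NormedSpace ℂ E] [FiniteDimensional ℂ E]

/-- Hartogs extension by discs parallel to the line `ℂ v`. -/
theorem exists_extension_of_discs {ρ : E → ℝ} (hρ : Continuous ρ) {Ω : Set E} (hΩ : IsOpen Ω)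
    (h0 : (0 : E) ∈ Ω) {v w : E} (hv : ∀ ζ : ℂ, ζ ≠ 0 → ρ (ζ • v) < 0)
    (hw : ∀ a : ℝ, 0 < a → ∀ ζ : ℂ, ρ (a • w + ζ • v) < 0) :
    ∃ U : Set E, IsOpen U ∧ Convex ℝ U ∧ 0 ∈ U ∧ U ⊆ Ω ∧ ∃ z₀ ∈ U, ρ z₀ < 0 ∧
      ∀ f : E → ℂ, DifferentiableOn ℂ f {z | z ∈ Ω ∧ ρ z < 0} →
        ∃ F : E → ℂ, DifferentiableOn ℂ F U ∧ F =ᶠ[𝓝 z₀] f := by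
  have hD : IsOpen {z | z ∈ Ω ∧ ρ z < 0} := hΩ.inter (isOpen_lt hρ continuous_const)
  obtain ⟨r, hr, hrΩ⟩ : ∃ r > 0, ∀ s ∈ Metric.closedBall (0 : ℂ) r, s • v ∈ Ω := by
    have hc : ContinuousAt (fun s : ℂ => s • v) 0 := by fun_prop
    obtain ⟨r, hr, h⟩ := Metric.nhds_basis_closedBall.mem_iff.1
      (hc.preimage_mem_nhds (hΩ.mem_nhds (by simpa using h0)))
    exact ⟨r, hr, fun s hs => h hs⟩
  have h1 : ∀ᶠ p : E in 𝓝 0, ∀ s ∈ Metric.closedBall (0 : ℂ) r, p + s • v ∈ Ω := by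
    refine (isCompact_closedBall _ _).eventually_forall_of_forall_eventually fun s hs => ?_
    have hc : ContinuousAt (fun q : E × ℂ => q.1 + q.2 • v) (0, s) := by fun_prop
    exact hc.eventually (hΩ.mem_nhds (by simpa using hrΩ s hs))
  have h2 : ∀ᶠ p : E in 𝓝 0, ∀ s ∈ Metric.sphere (0 : ℂ) r, ρ (p + s • v) < 0 := by
    refine (isCompact_sphere _ _).eventually_forall_of_forall_eventually fun s hs => ?_
    have hc : ContinuousAt (fun q : E × ℂ => ρ (q.1 + q.2 • v)) (0, s) := by fun_prop
    refine hc.eventually (gt_mem_nhds ?_)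
    simpa using hv s (ne_zero_of_mem_sphere hr.ne' ⟨s, hs⟩)
  obtain ⟨δ, hδ, hδ'⟩ := Metric.eventually_nhds_iff_ball.1 (h1.and h2)
  obtain ⟨a, ha, haδ⟩ : ∃ a : ℝ, 0 < a ∧ a • w ∈ Metric.ball (0 : E) δ := by
    have hc : ContinuousAt (fun a : ℝ => a • w) 0 := by fun_prop
    obtain ⟨η, hη, h⟩ := Metric.mem_nhds_iff.1
      (hc.preimage_mem_nhds (t := Metric.ball (0 : E) δ)
        (Metric.isOpen_ball.mem_nhds (by simpa using hδ)))
    exact ⟨η / 2, by positivity, h (show η / 2 ∈ Metric.ball (0 : ℝ) η by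
      simp [abs_of_pos hη, hη])⟩
  refine ⟨Metric.ball 0 δ, Metric.isOpen_ball, convex_ball _ _, Metric.mem_ball_self hδ,
    fun z hz => by simpa using (hδ' z hz).1 0 (Metric.mem_closedBall_self hr.le), a • w, haδ,
    by simpa using hw a ha 0, fun f hf => ?_⟩
  set W : Set (ℂ × E) := {q | q.1 ≠ 0} ∩
    (fun q : ℂ × E => q.2 + q.1 • v) ⁻¹' {z | z ∈ Ω ∧ ρ z < 0} with hW
  have hWo : IsOpen W := (isOpen_ne_fun (by fun_prop) continuous_const).inter
    (hD.preimage (by fun_prop))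
  have hG : DifferentiableOn ℂ (fun q : ℂ × E => q.1⁻¹ * f (q.2 + q.1 • v)) W :=
    DifferentiableOn.mul (DifferentiableOn.inv (by fun_prop) fun q hq => hq.1)
      (hf.comp (by fun_prop) fun q hq => hq.2)
  have hsph : ∀ s ∈ Metric.sphere (0 : ℂ) r, ∀ z ∈ Metric.ball (0 : E) δ, (s, z) ∈ W :=
    fun s hs z hz => ⟨ne_zero_of_mem_sphere hr.ne' ⟨s, hs⟩,
      (hδ' z hz).1 s (Metric.sphere_subset_closedBall hs), (hδ' z hz).2 s hs⟩
  -- The mean of `f` over a circle makes sense near `0`, where only the boundary of the disc need be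
  -- in `{ρ < 0}`; it equals `f z` once the whole disc is there, as happens near `a • w`.
  refine ⟨fun z => (2 * Real.pi * Complex.I)⁻¹ * ∮ s in C(0, r), s⁻¹ * f (z + s • v),
    (differentiableOn_circleIntegral hWo hG Metric.isOpen_ball hr.le hsph).const_mul _, ?_⟩
  have h3 : ∀ᶠ z : E in 𝓝 (a • w), ∀ s ∈ Metric.closedBall (0 : ℂ) r, ρ (z + s • v) < 0 := by
    refine (isCompact_closedBall _ _).eventually_forall_of_forall_eventually fun s hs => ?_
    have hc : ContinuousAt (fun q : E × ℂ => ρ (q.1 + q.2 • v)) (a • w, s) := by fun_prop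
    exact hc.eventually (gt_mem_nhds (hw a ha s))
  filter_upwards [h3, Metric.isOpen_ball.mem_nhds haδ] with z hz hzU
  have hd : DifferentiableOn ℂ (fun s : ℂ => f (z + s • v)) (Metric.closedBall 0 r) :=
    (differentiableOn_comp_line hD hf z v).mono fun s hs => ⟨(hδ' z hzU).1 s hs, hz s hs⟩
  have := hd.circleIntegral_sub_inv_smul (w := 0) (Metric.mem_ball_self hr)
  simp only [smul_eq_mul, sub_zero, zero_smul, add_zero] at this
  rw [this, ← mul_assoc, inv_mul_cancel₀ Complex.two_pi_I_ne_zero, one_mul]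

/-- Hartogs extension by the curves `ζ η = t` in the planes parallel to `ℂ u₁ + ℂ u₂`, where `ζ`,
`η` are the coordinates along `u₁`, `u₂`. -/
theorem exists_extension_of_hyperbolas {ρ : E → ℝ} (hρ : Continuous ρ) {Ω : Set E}
    (hΩ : IsOpen Ω) (h0 : (0 : E) ∈ Ω) {u₁ u₂ : E} {l₁ l₂ : E →L[ℂ] ℂ} (h₁₁ : l₁ u₁ = 1)
    (h₁₂ : l₁ u₂ = 0) (h₂₁ : l₂ u₁ = 0) (h₂₂ : l₂ u₂ = 1)
    (hu₁ : ∀ ζ : ℂ, ζ ≠ 0 → ρ (ζ • u₁) < 0) (hu₂ : ∀ ζ : ℂ, ζ ≠ 0 → ρ (ζ • u₂) < 0)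
    (hu : ∀ ζ η : ℂ, ∀ t : ℝ, 0 < t → ζ * η = -t → ρ (ζ • u₁ + η • u₂) < 0) :
    ∃ U : Set E, IsOpen U ∧ Convex ℝ U ∧ 0 ∈ U ∧ U ⊆ Ω ∧ ∃ z₀ ∈ U, ρ z₀ < 0 ∧
      ∀ f : E → ℂ, DifferentiableOn ℂ f {z | z ∈ Ω ∧ ρ z < 0} →
        ∃ F : E → ℂ, DifferentiableOn ℂ F U ∧ F =ᶠ[𝓝 z₀] f := by
  have hD : IsOpen {z | z ∈ Ω ∧ ρ z < 0} := hΩ.inter (isOpen_lt hρ continuous_const)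
  obtain ⟨r, hr, hrΩ⟩ : ∃ r > 0, ∀ q ∈ Metric.closedBall (0 : ℂ × ℂ) r,
      q.1 • u₁ + q.2 • u₂ ∈ Ω := by
    have hc : ContinuousAt (fun q : ℂ × ℂ => q.1 • u₁ + q.2 • u₂) 0 := by fun_prop
    obtain ⟨r, hr, h⟩ := Metric.nhds_basis_closedBall.mem_iff.1
      (hc.preimage_mem_nhds (hΩ.mem_nhds (by simpa using h0)))
    exact ⟨r, hr, fun s hs => h hs⟩
  have h1 : ∀ᶠ q : E × ℂ in 𝓝 0, ∀ s ∈ Metric.closedBall (0 : ℂ × ℂ) r,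
      q.1 + (s.1 • u₁ + s.2 • u₂) ∈ Ω := by
    refine (isCompact_closedBall _ _).eventually_forall_of_forall_eventually fun s hs => ?_
    have hc : ContinuousAt (fun q : (E × ℂ) × (ℂ × ℂ) => q.1.1 + (q.2.1 • u₁ + q.2.2 • u₂))
      (0, s) := by fun_prop
    exact hc.eventually (hΩ.mem_nhds (by simpa using hrΩ s hs))
  have h2 : ∀ {x y : E}, (∀ ζ : ℂ, ζ ≠ 0 → ρ (ζ • x) < 0) →
      ∀ᶠ q : E × ℂ in 𝓝 0, ∀ s ∈ Metric.sphere (0 : ℂ) r,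
        ρ (q.1 + (s • x + (q.2 / s) • y)) < 0 := by
    intro x y hx
    refine (isCompact_sphere _ _).eventually_forall_of_forall_eventually fun s hs => ?_
    have hs0 : s ≠ 0 := ne_zero_of_mem_sphere hr.ne' ⟨s, hs⟩
    have hc : ContinuousAt (fun q : (E × ℂ) × ℂ => ρ (q.1.1 + (q.2 • x + (q.1.2 / q.2) • y)))
        (0, s) := by
      refine hρ.continuousAt.comp ?_
      have : ContinuousAt (fun q : (E × ℂ) × ℂ => q.1.2 / q.2) (0, s) :=
        ContinuousAt.div (by fun_prop) (by fun_prop) hs0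
      exact ContinuousAt.add (by fun_prop)
        (ContinuousAt.add (by fun_prop) (this.smul continuousAt_const))
    refine hc.eventually (gt_mem_nhds ?_)
    simpa using hx s hs0
  obtain ⟨δ₀, hδ₀, hδ₀'⟩ := Metric.eventually_nhds_iff_ball.1
    (h1.and ((h2 (y := u₂) hu₁).and (h2 (y := u₁) hu₂)))
  -- The bound by `1` keeps the product `l₁ z * l₂ z` below `δ`; the bound by `r` keeps both
  -- coordinates inside the circles of integration.
  set δ := min δ₀ (min 1 r) with hδdef
  have hδ : 0 < δ := lt_min hδ₀ (lt_min one_pos hr)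
  have hδ1 : δ ≤ 1 := (min_le_right _ _).trans (min_le_left _ _)
  have hδr : δ ≤ r := (min_le_right _ _).trans (min_le_right _ _)
  set P : E → E := fun z => z - (l₁ z • u₁ + l₂ z • u₂) with hP
  have hPc : Continuous P := by fun_prop
  set U : Set E := ({z | ‖l₁ z‖ < δ} ∩ {z | ‖l₂ z‖ < δ}) ∩ {z | ‖P z‖ < δ} with hU
  have hUo : IsOpen U := ((isOpen_lt (by fun_prop) continuous_const).inter
    (isOpen_lt (by fun_prop) continuous_const)).inter (isOpen_lt (by fun_prop) continuous_const)
  have hUc : Convex ℝ U := by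
    have e1 : ∀ l : E →L[ℂ] ℂ, {z : E | ‖l z‖ < δ} =
        (l.restrictScalars ℝ) ⁻¹' Metric.ball 0 δ := by
      intro l; ext z; simp
    have e2 : {z : E | ‖P z‖ < δ} = ((ContinuousLinearMap.id ℂ E -
        (l₁.smulRight u₁ + l₂.smulRight u₂)).restrictScalars ℝ) ⁻¹' Metric.ball 0 δ := by
      ext z; simp [hP]
    rw [hU, e1, e1, e2]
    exact (((convex_ball _ _).linear_preimage (l₁.restrictScalars ℝ).toLinearMap).inter
      ((convex_ball _ _).linear_preimage (l₂.restrictScalars ℝ).toLinearMap)).inter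
      ((convex_ball _ _).linear_preimage ((ContinuousLinearMap.id ℂ E -
        (l₁.smulRight u₁ + l₂.smulRight u₂)).restrictScalars ℝ).toLinearMap)
  have hmem : ∀ z ∈ U, (P z, l₁ z * l₂ z) ∈ Metric.ball (0 : E × ℂ) δ₀ := by
    intro z hz
    have hδδ : δ ≤ δ₀ := min_le_left _ _
    have ha : ‖l₁ z‖ < δ := hz.1.1
    have hb : ‖l₂ z‖ < δ := hz.1.2
    have hc : ‖P z‖ < δ := hz.2
    have hd : ‖l₁ z * l₂ z‖ < δ := by
      rw [norm_mul]
      calc ‖l₁ z‖ * ‖l₂ z‖ ≤ ‖l₁ z‖ * 1 :=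
            mul_le_mul_of_nonneg_left (hb.le.trans hδ1) (norm_nonneg _)
        _ < δ := by rw [mul_one]; exact ha
    rw [mem_ball_zero_iff, Prod.norm_mk]
    exact max_lt (hc.trans_le hδδ) (hd.trans_le hδδ)
  have hinΩ : ∀ z ∈ U, ∀ ζ η : ℂ, ‖ζ‖ ≤ r → ‖η‖ ≤ r → P z + (ζ • u₁ + η • u₂) ∈ Ω := by
    intro z hz ζ η hζ hη
    refine (hδ₀' _ (hmem z hz)).1 (ζ, η) ?_
    rw [mem_closedBall_zero_iff, Prod.norm_mk]
    exact max_le hζ hη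
  have hPz : ∀ z, P z + (l₁ z • u₁ + l₂ z • u₂) = z := fun z => by simp [hP]
  have hUΩ : U ⊆ Ω := by
    intro z hz
    have := hinΩ z hz (l₁ z) (l₂ z) (hz.1.1.le.trans hδr) (hz.1.2.le.trans hδr)
    rwa [hPz] at this
  have hdivr : ∀ z ∈ U, ∀ s : ℂ, ‖s‖ = r → ‖l₁ z * l₂ z / s‖ ≤ r := by
    intro z hz s hs
    rw [norm_div, hs, norm_mul, div_le_iff₀ hr]
    exact mul_le_mul (hz.1.1.le.trans hδr) (hz.1.2.le.trans hδr) (norm_nonneg _) hr.le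
  set a : ℝ := δ / 2 with ha
  have ha0 : 0 < a := by positivity
  -- Its coordinates have product `-a² < 0`, so the whole curve through `z₀` lies in the negative
  -- side.
  set z₀ : E := (a : ℂ) • u₁ + (-a : ℂ) • u₂ with hz₀
  have hl1 : l₁ z₀ = a := by simp [hz₀, h₁₁, h₁₂]
  have hl2 : l₂ z₀ = -a := by simp [hz₀, h₂₁, h₂₂]
  have hPz₀ : P z₀ = 0 := by
    simp only [hP, hl1, hl2]
    rw [hz₀, sub_self]
  have hna : ‖(a : ℂ)‖ = a := by simp [abs_of_pos ha0]
  have hz₀U : z₀ ∈ U := by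
    refine ⟨⟨?_, ?_⟩, ?_⟩
    · show ‖l₁ z₀‖ < δ
      rw [hl1, hna, ha]; linarith
    · show ‖l₂ z₀‖ < δ
      rw [hl2, norm_neg, hna, ha]; linarith
    · show ‖P z₀‖ < δ
      rw [hPz₀, norm_zero]; exact hδ
  have hρz₀ : ρ z₀ < 0 := hu a (-a) (a ^ 2) (by positivity) (by push_cast; ring)
  refine ⟨U, hUo, hUc, ⟨⟨by simpa using hδ, by simpa using hδ⟩, by simpa [hP] using hδ⟩, hUΩ,
    z₀, hz₀U, hρz₀, fun f hf => ?_⟩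
  have hsne : ∀ s ∈ Metric.sphere (0 : ℂ) r, s ≠ 0 := fun s hs =>
    ne_zero_of_mem_sphere hr.ne' ⟨s, hs⟩
  have hslne : ∀ l : E →L[ℂ] ℂ, ∀ z, ‖l z‖ < δ → ∀ s ∈ Metric.sphere (0 : ℂ) r, s - l z ≠ 0 := by
    intro l z hz s hs h
    have e : ‖s‖ = r := by simpa using hs
    rw [← sub_eq_zero.1 h, e] at hz
    exact absurd hz (not_lt.2 hδr)
  have hdivm : ∀ {c : ℂ × E → ℂ}, Differentiable ℂ c →
      DifferentiableOn ℂ (fun q => c q / q.1) {q | q.1 ≠ 0} := by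
    intro c hc
    simp only [div_eq_mul_inv]
    exact hc.differentiableOn.mul (differentiableOn_fst.inv fun q hq => hq)
  have hgen : ∀ (l : E →L[ℂ] ℂ) (x y : E), (∀ z ∈ U, ‖l z‖ < δ) →
      (∀ s ∈ Metric.sphere (0 : ℂ) r, ∀ z ∈ U,
        P z + (s • x + (l₁ z * l₂ z / s) • y) ∈ {z | z ∈ Ω ∧ ρ z < 0}) →
      ∀ c : ℂ × E → ℂ, DifferentiableOn ℂ c {q | q.1 ≠ 0} →
      DifferentiableOn ℂ (fun z => ∮ s in C(0, r), c (s, z) * ((s - l z)⁻¹ *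
        f (P z + (s • x + (l₁ z * l₂ z / s) • y)))) U := by
    intro l x y hl hin c hcd
    have hm : ContinuousOn (fun q : ℂ × E => P q.2 + (q.1 • x + (l₁ q.2 * l₂ q.2 / q.1) • y))
        {q | q.1 ≠ 0} := by
      refine ContinuousOn.add (by fun_prop) (ContinuousOn.add (by fun_prop)
        (ContinuousOn.smul (ContinuousOn.div (by fun_prop) (by fun_prop) fun q hq => hq)
          continuousOn_const))
    have hdiv : DifferentiableOn ℂ (fun q : ℂ × E => l₁ q.2 * l₂ q.2 / q.1) {q | q.1 ≠ 0} :=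
      hdivm (by fun_prop)
    have hmd : DifferentiableOn ℂ
        (fun q : ℂ × E => P q.2 + (q.1 • x + (l₁ q.2 * l₂ q.2 / q.1) • y)) {q | q.1 ≠ 0} := by
      exact DifferentiableOn.add (by fun_prop) (DifferentiableOn.add (by fun_prop)
        (hdiv.smul_const _))
    have hN : IsOpen {q : ℂ × E | q.1 ≠ 0} := isOpen_ne_fun continuous_fst continuous_const
    have hWo := (hm.isOpen_inter_preimage hN hD).inter
      (isOpen_ne_fun (f := fun q : ℂ × E => q.1 - l q.2) (g := fun _ => 0)
        (by fun_prop) continuous_const)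
    refine differentiableOn_circleIntegral (G := fun q : ℂ × E => c q * ((q.1 - l q.2)⁻¹ *
      f (P q.2 + (q.1 • x + (l₁ q.2 * l₂ q.2 / q.1) • y)))) hWo ?_ hUo hr.le ?_
    · refine (hcd.mono fun q hq => hq.1.1).mul (DifferentiableOn.mul
        (DifferentiableOn.inv (by fun_prop) fun q hq => hq.2) ?_)
      exact hf.comp (hmd.mono fun q hq => hq.1.1) fun q hq => hq.1.2
    · exact fun s hs z hz => ⟨⟨hsne s hs, hin s hs z hz⟩, hslne l z (hl z hz) s hs⟩
  -- The two boundary circles of the annulus on `ζ η = t` enter separately. The inner one is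
  -- parametrised by the coordinate `η = s`, so that the integral stays holomorphic at `t = 0`; the
  -- kernel `l₂ z / s * (s - l₂ z)⁻¹` is what the substitution `s ↦ t / s` makes of the Cauchy
  -- kernel.
  have hF1 := hgen l₁ u₁ u₂ (fun z hz => hz.1.1) (fun s hs z hz =>
    ⟨hinΩ z hz s _ (by simpa using hs.le) (hdivr z hz s (by simpa using hs)),
      (hδ₀' _ (hmem z hz)).2.1 s hs⟩) (fun _ => 1) (by fun_prop)
  have hF2 := hgen l₂ u₂ u₁ (fun z hz => hz.1.2) (fun s hs z hz =>
    ⟨by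
      rw [add_comm (s • u₂)]
      exact hinΩ z hz _ s (hdivr z hz s (by simpa using hs)) (by simpa using hs.le),
      (hδ₀' _ (hmem z hz)).2.2 s hs⟩) (fun q => l₂ q.2 / q.1)
      (hdivm (by fun_prop))
  refine ⟨_, (hF1.add hF2).const_mul (2 * Real.pi * Complex.I)⁻¹, ?_⟩
  -- A fixed compact annulus containing all `‖t‖ / r ≤ ‖s‖ ≤ r` with `‖t‖ > a² / 2`; compactness
  -- thus handles an annulus that varies with `z`.
  set A : Set ℂ := Metric.closedBall 0 r \ Metric.ball 0 (a ^ 2 / (2 * r)) with hA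
  have hAne : ∀ s ∈ A, s ≠ 0 := by
    rintro s hs rfl
    exact hs.2 (Metric.mem_ball_self (by positivity))
  have h3 : ∀ᶠ z : E in 𝓝 z₀, ∀ s ∈ A, ρ (P z + (s • u₁ + (l₁ z * l₂ z / s) • u₂)) < 0 := by
    refine ((isCompact_closedBall _ _).diff
      Metric.isOpen_ball).eventually_forall_of_forall_eventually fun s hs => ?_
    have hc : ContinuousAt (fun q : E × ℂ =>
        ρ (P q.1 + (q.2 • u₁ + (l₁ q.1 * l₂ q.1 / q.2) • u₂))) (z₀, s) := by
      refine hρ.continuousAt.comp ?_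
      have : ContinuousAt (fun q : E × ℂ => l₁ q.1 * l₂ q.1 / q.2) (z₀, s) :=
        ContinuousAt.div (by fun_prop) (by fun_prop) (hAne s hs)
      exact ContinuousAt.add (by fun_prop)
        (ContinuousAt.add (by fun_prop) (this.smul continuousAt_const))
    refine hc.eventually (gt_mem_nhds ?_)
    simp only [hPz₀, hl1, hl2, zero_add]
    refine hu _ _ (a ^ 2) (by positivity) ?_
    have := hAne s hs
    push_cast
    field_simp
  have h4 : ∀ᶠ z : E in 𝓝 z₀, a ^ 2 / 2 < ‖l₁ z * l₂ z‖ := by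
    have hc : ContinuousAt (fun z => ‖l₁ z * l₂ z‖) z₀ := by fun_prop
    refine hc.eventually (lt_mem_nhds ?_)
    show a ^ 2 / 2 < ‖l₁ z₀ * l₂ z₀‖
    rw [hl1, hl2, norm_mul, norm_neg, hna]
    nlinarith
  filter_upwards [h3, h4, hUo.mem_nhds hz₀U] with z hz ht hzU
  set t := l₁ z * l₂ z with htdef
  have ht0 : t ≠ 0 := norm_pos_iff.1 (lt_trans (by positivity) ht)
  have hζ0 : l₁ z ≠ 0 := left_ne_zero_of_mul ht0
  have hη0 : l₂ z ≠ 0 := right_ne_zero_of_mul ht0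
  set g : ℂ → ℂ := fun s => f (P z + (s • u₁ + (t / s) • u₂)) with hg
  have hm : ContinuousOn (fun s : ℂ => P z + (s • u₁ + (t / s) • u₂)) {s | s ≠ 0} :=
    ContinuousOn.add (by fun_prop) (ContinuousOn.add (by fun_prop)
      (ContinuousOn.smul (ContinuousOn.div (by fun_prop) (by fun_prop) fun q hq => hq)
          continuousOn_const))
  have hdiv : DifferentiableOn ℂ (fun s : ℂ => t / s) {s | s ≠ 0} := by
    refine DifferentiableOn.fun_div ?_ ?_ fun q hq => hq <;> fun_prop
  have hmd : DifferentiableOn ℂ (fun s : ℂ => P z + (s • u₁ + (t / s) • u₂)) {s | s ≠ 0} :=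
    DifferentiableOn.add (by fun_prop) (DifferentiableOn.add (by fun_prop)
      (hdiv.smul_const _))
  have hO := hm.isOpen_inter_preimage (isOpen_ne_fun continuous_id continuous_const) hD
  have hgd : DifferentiableOn ℂ g _ := hf.comp (hmd.mono Set.inter_subset_left) fun s hs => hs.2
  have hcauchy := circleIntegral_sub_inv_mul_annulus (r := ‖t‖ / r) (R := r)
    (div_pos (norm_pos_iff.2 ht0) hr) hO hgd (fun s hs1 hs2 => by
      have hspos : 0 < ‖s‖ := lt_of_lt_of_le (div_pos (norm_pos_iff.2 ht0) hr) hs1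
      refine ⟨norm_pos_iff.1 hspos, hinΩ z hzU _ _ hs2 ?_, hz s ⟨by simpa using hs2, ?_⟩⟩
      · rw [norm_div, div_le_iff₀ hspos, mul_comm]
        exact (div_le_iff₀ hr).1 hs1
      · simp only [Metric.mem_ball, dist_zero_right, not_lt]
        refine le_trans ?_ hs1
        rw [div_le_div_iff₀ (by positivity) hr]
        nlinarith) (ζ := l₁ z) (by
      rw [htdef, norm_mul, div_lt_iff₀ hr]
      exact mul_lt_mul_of_pos_left (lt_of_lt_of_le hzU.1.2 hδr) (norm_pos_iff.2 hζ0))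
      (lt_of_lt_of_le hzU.1.1 hδr)
  have hsubst : (∮ s in C(0, ‖t‖ / r), (s - l₁ z)⁻¹ * g s) =
      -∮ s in C(0, r), l₂ z / s * ((s - l₂ z)⁻¹ * f (P z + (s • u₂ + (t / s) • u₁))) := by
    rw [circleIntegral_div hr, ← neg_one_mul, ← circleIntegral.integral_const_mul]
    refine circleIntegral.integral_congr hr.le fun s hs => ?_
    have hs0 := hsne s hs
    have hs2 := hslne l₂ z hzU.1.2 s hs
    have hs3 : l₂ z - s ≠ 0 := fun h => hs2 (by linear_combination -h)
    have e1 : t / (t / s) = s := by field_simp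
    have e2 : t / s - l₁ z = l₁ z * (l₂ z - s) / s := by rw [htdef]; field_simp
    simp only [hg, e1, e2]
    rw [add_comm (s • u₂), htdef]
    have e3 : s - l₂ z = -(l₂ z - s) := by ring
    rw [e3]
    field_simp
  rw [hsubst] at hcauchy
  simp only [one_mul]
  have e4 : (2 * Real.pi * Complex.I)⁻¹ * (2 * Real.pi * Complex.I * g (l₁ z)) = f z := by
    rw [← mul_assoc, inv_mul_cancel₀ Complex.two_pi_I_ne_zero, one_mul, hg]
    have : t / l₁ z = l₂ z := by rw [htdef]; field_simp
    simp only [this, hPz]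
  rw [← e4, ← hcauchy, sub_neg_eq_add]
  rfl

end Extension

/-! ### From approximation on complex lines to approximation on the whole space. -/

section Duality

/-- A real-linear map dominated by `A` factors through `A` with a contraction. -/
theorem exists_contraction_comp_eq {V F G : Type*} [AddCommGroup V] [Module ℝ V]
    [NormedAddCommGroup F] [InnerProductSpace ℝ F] [FiniteDimensional ℝ F]
    [NormedAddCommGroup G] [NormedSpace ℝ G] (A : V →ₗ[ℝ] F) (T : V →ₗ[ℝ] G)
    (h : ∀ x, ‖T x‖ ≤ ‖A x‖) : ∃ S : F →L[ℝ] G, ‖S‖ ≤ 1 ∧ ∀ x, S (A x) = T x := by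
  obtain ⟨g, hg⟩ := A.rangeRestrict.exists_rightInverse_of_surjective A.range_rangeRestrict
  have hg' : ∀ e : LinearMap.range A, A (g e) = e := fun e => by
    have := LinearMap.congr_fun hg e
    exact congrArg Subtype.val this
  set S₀ : LinearMap.range A →L[ℝ] G := (T ∘ₗ g).mkContinuous 1 fun e => by
    rw [one_mul]
    refine (h (g e)).trans (le_of_eq ?_)
    rw [hg']; rfl with hS₀
  -- Orthogonal projection extends `S₀` from the range without increasing the norm. The choice of
  -- section `g` is harmless, since `h` forces `ker A ≤ ker T`.
  refine ⟨S₀.comp (LinearMap.range A).orthogonalProjectionOnto, ?_, fun x => ?_⟩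
  · refine (ContinuousLinearMap.opNorm_comp_le _ _).trans ?_
    have h1 : ‖S₀‖ ≤ 1 := LinearMap.mkContinuous_norm_le _ zero_le_one _
    exact mul_le_one₀ h1 (norm_nonneg _) (Submodule.orthogonalProjectionOnto_norm_le _)
  · have hx : (LinearMap.range A).orthogonalProjectionOnto (A x) = ⟨A x, x, rfl⟩ :=
      Submodule.orthogonalProjectionOnto_mem_subspace_eq_self (⟨A x, x, rfl⟩ : LinearMap.range A)
    rw [ContinuousLinearMap.comp_apply, hx]
    show T (g _) = T x
    rw [← sub_eq_zero, ← map_sub, ← norm_le_zero_iff]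
    refine (h _).trans (le_of_eq ?_)
    rw [map_sub, hg', sub_self, norm_zero]

/-- A positive semidefinite real quadratic form is the square of a seminorm coming from a linear map
to a Euclidean space. -/
theorem exists_norm_sq_eq {V : Type*} [AddCommGroup V] [Module ℝ V] [FiniteDimensional ℝ V]
    (S : V →ₗ[ℝ] V →ₗ[ℝ] ℝ) (hS : ∀ x y, S x y = S y x) (hpos : ∀ x, 0 ≤ S x x) :
    ∃ A : V →ₗ[ℝ] EuclideanSpace ℝ (Fin (Module.finrank ℝ V)), ∀ x, ‖A x‖ ^ 2 = S x x := by
  obtain ⟨v, hv⟩ := LinearMap.BilinForm.exists_orthogonal_basis (B := S) ⟨fun x y => hS x y⟩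
  -- Coordinates in an `S`-orthogonal basis, weighted by the square roots of the diagonal entries;
  -- null basis vectors get weight zero.
  refine ⟨(WithLp.linearEquiv 2 ℝ _).symm.toLinearMap ∘ₗ
    LinearMap.pi fun i => Real.sqrt (S (v i) (v i)) • v.coord i, fun x => ?_⟩
  rw [EuclideanSpace.norm_sq_eq]
  have hx : S x x = ∑ i, ∑ j, v.repr x i * (v.repr x j * S (v i) (v j)) := by
    conv_lhs => rw [← v.sum_repr x]
    simp only [map_sum, LinearMap.sum_apply, map_smul, LinearMap.smul_apply, smul_eq_mul,
      Finset.mul_sum]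
    refine Finset.sum_congr rfl fun i _ => Finset.sum_congr rfl fun j _ => ?_
    rw [hS]
  rw [hx]
  refine Finset.sum_congr rfl fun i _ => ?_
  rw [Finset.sum_eq_single i]
  · simp [mul_pow, Real.sq_sqrt (hpos (v i))]
    ring
  · intro j _ hj
    have : S (v i) (v j) = 0 := hv hj.symm
    rw [this, mul_zero, mul_zero]
  · simp

variable {E : Type*} [NormedAddCommGroup E] [NormedSpace ℂ E]

/-- Twice the antilinear part of a real-linear functional. -/
def antilinearPart (T : E →ₗ[ℝ] ℂ) : E →ₛₗ[starRingEnd ℂ] ℂ where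
  toFun z := T z + Complex.I * T (Complex.I • z)
  map_add' x y := by simp only [smul_add, map_add]; ring
  map_smul' ζ z := by
    have key : ∀ y : E, T (ζ • y) = ζ.re * T y + ζ.im * T (Complex.I • y) := by
      intro y
      have : ζ • y = ζ.re • y + ζ.im • (Complex.I • y) := by
        conv_lhs => rw [← Complex.re_add_im ζ]
        rw [add_smul, mul_smul, Complex.coe_smul, Complex.coe_smul]
      rw [this, map_add, map_smul, map_smul, Complex.real_smul, Complex.real_smul]
    have hI : Complex.I • ζ • z = ζ • Complex.I • z := smul_comm _ _ _
    have hII : Complex.I • Complex.I • z = -z := by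
      rw [smul_smul, Complex.I_mul_I, neg_one_smul]
    rw [hI, key, key, hII, map_neg]
    have hc : (starRingEnd ℂ) ζ = ζ.re - ζ.im * Complex.I := by
      apply Complex.ext <;> simp
    rw [smul_eq_mul, hc]
    linear_combination ((ζ.im : ℂ) * T (Complex.I • z)) * Complex.I_sq

theorem antilinearPart_apply (T : E →ₗ[ℝ] ℂ) (z : E) :
    antilinearPart T z = T z + Complex.I * T (Complex.I • z) := rfl

theorem antilinearPart_add (T T' : E →ₗ[ℝ] ℂ) (z : E) :
    antilinearPart (T + T') z = antilinearPart T z + antilinearPart T' z := by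
  simp only [antilinearPart_apply, LinearMap.add_apply]; ring

/-- A real-linear functional with vanishing antilinear part, as a complex-linear functional. -/
def complexLinearOf (T : E →ₗ[ℝ] ℂ) (h : ∀ z, antilinearPart T z = 0) : E →ₗ[ℂ] ℂ where
  toFun := T
  map_add' := T.map_add
  map_smul' ζ z := by
    have hI : T (Complex.I • z) = Complex.I * T z := by
      have := h z
      rw [antilinearPart_apply] at this
      linear_combination (-Complex.I) * this + T (Complex.I • z) * Complex.I_sq
    have : ζ • z = ζ.re • z + ζ.im • (Complex.I • z) := by
      conv_lhs => rw [← Complex.re_add_im ζ]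
      rw [add_smul, mul_smul, Complex.coe_smul, Complex.coe_smul]
    rw [this, map_add, map_smul, map_smul, Complex.real_smul, Complex.real_smul, hI,
      RingHom.id_apply, smul_eq_mul]
    conv_rhs => rw [← Complex.re_add_im ζ]
    ring

/-- If a real-linear functional `c` can be approximated on every complex line, within a Euclidean
seminorm, by complex-linear functionals, then it can be so on the whole space. -/
theorem exists_complexLinear_near [FiniteDimensional ℂ E] (S : E →ₗ[ℝ] E →ₗ[ℝ] ℝ)
    (hS : ∀ x y, S x y = S y x) (hpos : ∀ x, 0 ≤ S x x) (c : E →ₗ[ℝ] ℂ)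
    (h : ∀ w : E, ∃ b : ℂ, ∀ ζ : ℂ, ‖c (ζ • w) - ζ * b‖ ^ 2 ≤ S (ζ • w) (ζ • w)) :
    ∃ μ : E →ₗ[ℂ] ℂ, ∀ z, ‖c z - μ z‖ ^ 2 ≤ S z z := by
  have : FiniteDimensional ℝ E := FiniteDimensional.complexToReal E
  obtain ⟨A, hA⟩ := exists_norm_sq_eq S hS hpos
  set F := EuclideanSpace ℝ (Fin (Module.finrank ℝ E))
  set e := Module.finBasis ℂ E
  set Λ : (F →L[ℝ] ℂ) →ₗ[ℝ] (Fin (Module.finrank ℂ E) → ℂ) :=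
    { toFun := fun T j => antilinearPart (T.toLinearMap ∘ₗ A) (e j)
      map_add' := fun T T' => by
        funext j
        simp only [antilinearPart_apply, LinearMap.comp_apply, Pi.add_apply,
          ContinuousLinearMap.coe_coe, add_apply]
        ring
      map_smul' := fun a T => by
        funext j
        simp only [antilinearPart_apply, LinearMap.comp_apply, Pi.smul_apply,
          ContinuousLinearMap.coe_coe, smul_apply, RingHom.id_apply,
          Complex.real_smul]
        ring } with hΛ
  have hΛj : ∀ T j, Λ T j = antilinearPart (T.toLinearMap ∘ₗ A) (e j) := fun _ _ => rfl
  have : ProperSpace (F →L[ℝ] ℂ) := FiniteDimensional.proper ℝ _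
  have hcpt : IsCompact (Λ '' Metric.closedBall 0 1) :=
    (isCompact_closedBall _ _).image Λ.continuous_of_finiteDimensional
  have hconv : Convex ℝ (Λ '' Metric.closedBall 0 1) := (convex_closedBall _ _).linear_image Λ
  -- Membership means that some contraction `T` makes `c + T ∘ A` complex-linear. If it failed,
  -- Hahn-Banach would separate; but a linear functional on antilinear functionals is evaluation at
  -- a vector `w`, and on the line `ℂ w` the hypothesis already supplies such a `T`.
  have hmem : (fun j => -antilinearPart c (e j)) ∈ Λ '' Metric.closedBall 0 1 := by
    by_contra hnot
    obtain ⟨f, u, hf1, hf2⟩ := RCLike.geometric_hahn_banach_closed_point (𝕜 := ℂ) hconv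
      hcpt.isClosed hnot
    set w : E := ∑ j, (starRingEnd ℂ) (f (Pi.single j 1)) • e j with hw
    have hfτ : ∀ τ : E →ₛₗ[starRingEnd ℂ] ℂ, f (fun j => τ (e j)) = τ w := by
      intro τ
      rw [hw, map_sum]
      have : (fun j => τ (e j)) = ∑ j, τ (e j) • (Pi.single j (1 : ℂ) : Fin _ → ℂ) := by
        funext i
        simp [Finset.sum_apply, Pi.single_apply]
      rw [this, map_sum]
      refine Finset.sum_congr rfl fun j _ => ?_
      rw [map_smul, map_smulₛₗ, Complex.conj_conj, smul_eq_mul, smul_eq_mul, mul_comm]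
    obtain ⟨b, hb⟩ := h w
    set m : ℂ →ₗ[ℝ] E :=
      ((LinearMap.id : ℂ →ₗ[ℂ] ℂ).smulRight w).restrictScalars ℝ with hm
    have hmζ : ∀ ζ, m ζ = ζ • w := fun ζ => rfl
    set T₀ : ℂ →ₗ[ℝ] ℂ :=
      ((LinearMap.id : ℂ →ₗ[ℂ] ℂ).smulRight b).restrictScalars ℝ - c ∘ₗ m with hT₀
    have hT₀ζ : ∀ ζ, T₀ ζ = ζ * b - c (ζ • w) := fun ζ => rfl
    obtain ⟨T, hT1, hT2⟩ := exists_contraction_comp_eq (A ∘ₗ m) T₀ (fun ζ => by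
      refine (sq_le_sq₀ (norm_nonneg _) (norm_nonneg _)).1 ?_
      rw [LinearMap.comp_apply, hA, hT₀ζ, hmζ, norm_sub_rev]
      exact hb ζ)
    have h1 := hf1 (Λ T) ⟨T, by simpa using hT1, rfl⟩
    -- The antilinear part at `w` involves only the values at `w` and `i w`, where `T ∘ A` is `ζ b -
    -- c (ζ w)`; the complex-linear term `ζ b` drops out.
    have e1 : f (Λ T) = -antilinearPart c w := by
      have : Λ T = fun j => antilinearPart (T.toLinearMap ∘ₗ A) (e j) := rfl
      rw [this, hfτ, antilinearPart_apply, antilinearPart_apply]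
      have a1 := hT2 1
      have a2 := hT2 Complex.I
      simp only [LinearMap.comp_apply, hmζ, hT₀ζ, one_smul, one_mul] at a1 a2
      simp only [LinearMap.comp_apply, ContinuousLinearMap.coe_coe, a1, a2]
      linear_combination b * Complex.I_sq
    have e2 : f (fun j => -antilinearPart c (e j)) = -antilinearPart c w := by
      rw [← hfτ (antilinearPart c), ← map_neg]
      rfl
    rw [e1] at h1
    rw [e2] at hf2
    exact lt_asymm h1 hf2
  obtain ⟨T, hT, hTe⟩ := hmem
  have hT1 : ‖T‖ ≤ 1 := by simpa using hT
  have hanti : antilinearPart (c + T.toLinearMap ∘ₗ A) = 0 := by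
    refine e.ext fun j => ?_
    have := congrFun hTe j
    rw [hΛj] at this
    rw [antilinearPart_add, this]
    simp
  refine ⟨complexLinearOf _ (fun z => LinearMap.congr_fun hanti z), fun z => ?_⟩
  have : c z - complexLinearOf (c + T.toLinearMap ∘ₗ A) (fun z => LinearMap.congr_fun hanti z) z =
      -T (A z) := by
    show c z - (c z + T (A z)) = _
    ring
  rw [this, norm_neg, ← hA]
  refine pow_le_pow_left₀ (norm_nonneg _) ?_ 2
  simpa using T.le_of_opNorm_le hT1 (A z)

end Duality

/-! ### Hermitian and complex parts of a real quadratic form; connectedness of the negative side. -/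

section RealQuadraticForms

variable {E : Type*} [NormedAddCommGroup E] [NormedSpace ℂ E]

/-- The negative side of a quadratic cone, inside a convex neighbourhood of the origin, is connected
as soon as the form is negative on a complex line. -/
theorem isPreconnected_inter_neg (B : E →ₗ[ℝ] E →ₗ[ℝ] ℝ) (hB : ∀ x y, B x y = B y x) {U : Set E}
    (hUo : IsOpen U) (hUc : Convex ℝ U) (h0 : 0 ∈ U) {v : E}
    (hv : ∀ ζ : ℂ, ζ ≠ 0 → B (ζ • v) (ζ • v) < 0) : IsPreconnected (U ∩ {z | B z z < 0}) := by
  obtain ⟨s, hs, hsU⟩ : ∃ s > 0, ∀ ζ ∈ Metric.closedBall (0 : ℂ) s, ζ • v ∈ U := by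
    have hc : ContinuousAt (fun s : ℂ => s • v) 0 := by fun_prop
    obtain ⟨r, hr, h⟩ := Metric.nhds_basis_closedBall.mem_iff.1
      (hc.preimage_mem_nhds (hUo.mem_nhds (by simpa using h0)))
    exact ⟨r, hr, fun s hs => h hs⟩
  set C : Set E := (fun ζ : ℂ => ζ • v) '' Metric.sphere 0 s with hC
  have hCpre : IsPreconnected C :=
    (isPreconnected_sphere (by rw [Complex.rank_real_complex]; exact Nat.one_lt_ofNat) _ _).image _
      (by fun_prop)
  have hCsub : C ⊆ U ∩ {z | B z z < 0} := by
    rintro _ ⟨ζ, hζ, rfl⟩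
    exact ⟨hsU ζ (Metric.sphere_subset_closedBall hζ), hv ζ (ne_zero_of_mem_sphere hs.ne' ⟨ζ, hζ⟩)⟩
  have hsC : ((s : ℂ) • v) ∈ C := ⟨s, by simp [abs_of_pos hs], rfl⟩
  have hsC' : ((-s : ℂ) • v) ∈ C := ⟨-s, by simp [abs_of_pos hs], rfl⟩
  refine isPreconnected_of_forall ((s : ℂ) • v) fun y hy => ?_
  -- One of two antipodal points of the circle has nonpositive pairing with `y`, and then `B` is
  -- negative on the whole segment to it.
  obtain ⟨p, hpC, hp⟩ : ∃ p ∈ C, B y p ≤ 0 := by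
    rcases le_total (B y ((s : ℂ) • v)) 0 with h | h
    · exact ⟨_, hsC, h⟩
    · refine ⟨_, hsC', ?_⟩
      rw [neg_smul, map_neg]; linarith
  refine ⟨C ∪ segment ℝ y p, Set.union_subset hCsub ?_, Or.inl hsC,
    Or.inr (left_mem_segment ℝ y p), hCpre.union p hpC (right_mem_segment ℝ y p)
      (convex_segment y p).isPreconnected⟩
  rintro _ ⟨a, b, ha, hb, hab, rfl⟩
  refine ⟨hUc hy.1 (hCsub hpC).1 ha hb hab, ?_⟩
  have h1 : B y y < 0 := hy.2
  have h2 : B p p < 0 := (hCsub hpC).2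
  show B (a • y + b • p) (a • y + b • p) < 0
  simp only [map_add, map_smul, LinearMap.add_apply, LinearMap.smul_apply, smul_eq_mul]
  rw [hB p y]
  have h3 : a * b * B y p ≤ 0 := mul_nonpos_of_nonneg_of_nonpos (mul_nonneg ha hb) hp
  rcases ha.eq_or_lt with rfl | ha'
  · have : b = 1 := by linarith
    subst this; linarith
  · have h4 : a * a * B y y < 0 := mul_neg_of_pos_of_neg (mul_pos ha' ha') h1
    have h5 : b * b * B p p ≤ 0 := mul_nonpos_of_nonneg_of_nonpos (mul_nonneg hb hb) h2.le
    nlinarith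

/-- The Hermitian part of a real quadratic form. -/
def hermitianPart (B : E →ₗ[ℝ] E →ₗ[ℝ] ℝ) (z : E) : ℝ :=
  (B z z + B (Complex.I • z) (Complex.I • z)) / 2

theorem smul_eq_re_add_im (ζ : ℂ) (y : E) : ζ • y = ζ.re • y + ζ.im • (Complex.I • y) := by
  conv_lhs => rw [← Complex.re_add_im ζ]
  rw [add_smul, mul_smul, Complex.coe_smul, Complex.coe_smul]

theorem I_smul_I_smul (z : E) : Complex.I • Complex.I • z = -z := by
  rw [smul_smul, Complex.I_mul_I, neg_one_smul]

/-- The complex bilinear form whose real part is the non-Hermitian part of a real bilinear form. -/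
def complexPart (B : E →ₗ[ℝ] E →ₗ[ℝ] ℝ) : E →ₗ[ℂ] E →ₗ[ℂ] ℂ :=
  LinearMap.mk₂ ℂ (fun x y =>
    ⟨(B x y - B (Complex.I • x) (Complex.I • y)) / 2,
      -(B x (Complex.I • y) + B (Complex.I • x) y) / 2⟩)
    (fun x x' y => by
      apply Complex.ext <;> simp <;> ring)
    (fun ζ x y => by
      have h : Complex.I • ζ • x = ζ • Complex.I • x := smul_comm _ _ _
      rw [h, smul_eq_re_add_im ζ x, smul_eq_re_add_im ζ (Complex.I • x), I_smul_I_smul]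
      apply Complex.ext <;> simp <;> ring)
    (fun x y y' => by
      apply Complex.ext <;> simp <;> ring)
    (fun ζ x y => by
      have h : Complex.I • ζ • y = ζ • Complex.I • y := smul_comm _ _ _
      rw [h, smul_eq_re_add_im ζ y, smul_eq_re_add_im ζ (Complex.I • y), I_smul_I_smul]
      apply Complex.ext <;> simp <;> ring)

theorem complexPart_apply (B : E →ₗ[ℝ] E →ₗ[ℝ] ℝ) (x y : E) :
    complexPart B x y = ⟨(B x y - B (Complex.I • x) (Complex.I • y)) / 2,
      -(B x (Complex.I • y) + B (Complex.I • x) y) / 2⟩ := rfl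

theorem complexPart_symm {B : E →ₗ[ℝ] E →ₗ[ℝ] ℝ} (hB : ∀ x y, B x y = B y x) (x y : E) :
    complexPart B x y = complexPart B y x := by
  simp only [complexPart_apply]
  rw [hB y x, hB (Complex.I • y), hB y (Complex.I • x), hB (Complex.I • y) x,
    add_comm (B x (Complex.I • y))]

/-- Rotating `z` leaves the Hermitian part alone and turns the phase of the complex part, so on a
complex line the extreme values of `B` on the unit circle are `H ± |q|`. -/
theorem apply_smul_self {B : E →ₗ[ℝ] E →ₗ[ℝ] ℝ} (hB : ∀ x y, B x y = B y x) (ζ : ℂ) (z : E) :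
    B (ζ • z) (ζ • z) = ‖ζ‖ ^ 2 * hermitianPart B z + (ζ ^ 2 * complexPart B z z).re := by
  rw [smul_eq_re_add_im, complexPart_apply, hermitianPart, Complex.sq_norm, Complex.normSq_apply]
  simp [pow_two, hB (Complex.I • z) z]
  ring

theorem hermitianPart_smul {B : E →ₗ[ℝ] E →ₗ[ℝ] ℝ} (hB : ∀ x y, B x y = B y x) (ζ : ℂ) (z : E) :
    hermitianPart B (ζ • z) = ‖ζ‖ ^ 2 * hermitianPart B z := by
  unfold hermitianPart
  have h : Complex.I • ζ • z = (Complex.I * ζ) • z := smul_smul _ _ _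
  rw [h, apply_smul_self hB, apply_smul_self hB]
  have e : (Complex.I * ζ) ^ 2 * complexPart B z z = -(ζ ^ 2 * complexPart B z z) := by
    rw [mul_pow, Complex.I_sq]; ring
  rw [e, Complex.neg_re, norm_mul, Complex.norm_I, one_mul]
  unfold hermitianPart
  ring

theorem apply_self_eq {B : E →ₗ[ℝ] E →ₗ[ℝ] ℝ} (z : E) :
    B z z = hermitianPart B z + (complexPart B z z).re := by
  rw [complexPart_apply, hermitianPart]
  ring

/-- Uses `Re (ζ² q) ≥ -|ζ|² |q|`: a negative value anywhere on the line makes its minimum over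
phases negative. -/
theorem hermitianPart_lt_of_neg {B : E →ₗ[ℝ] E →ₗ[ℝ] ℝ} (hB : ∀ x y, B x y = B y x) {z : E}
    {ζ : ℂ} (h : B (ζ • z) (ζ • z) < 0) : hermitianPart B z < ‖complexPart B z z‖ := by
  rw [apply_smul_self hB] at h
  have h1 := Complex.abs_re_le_norm (ζ ^ 2 * complexPart B z z)
  rw [norm_mul, norm_pow] at h1
  have h2 := (abs_le.1 h1).1
  by_contra hc
  push Not at hc
  have := mul_le_mul_of_nonneg_left hc (sq_nonneg ‖ζ‖)
  linarith

theorem not_eventually_eq_zero_of_homogeneous {φ : E → ℂ} {k : ℕ}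
    (hφ : ∀ (a : ℝ) z, φ (a • z) = (a : ℂ) ^ k * φ z) {z : E} (hz : φ z ≠ 0) :
    ¬ ∀ᶠ y in 𝓝 0, φ y = 0 := by
  intro h
  have hc : Filter.Tendsto (fun a : ℝ => a • z) (𝓝[>] 0) (𝓝 0) := by
    have : Continuous fun a : ℝ => a • z := by fun_prop
    simpa using (this.tendsto 0).mono_left nhdsWithin_le_nhds
  obtain ⟨a, ha, ha0⟩ := ((hc.eventually h).and self_mem_nhdsWithin).exists
  rw [hφ] at ha
  have : (a : ℂ) ≠ 0 := by exact_mod_cast (ne_of_gt ha0)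
  exact mul_ne_zero (pow_ne_zero k this) hz ha

end RealQuadraticForms

/-! ### Extension from the negative side when no hypersurface lies in the other side. -/

section SideExtension

variable {E : Type*} [NormedAddCommGroup E] [NormedSpace ℂ E] [FiniteDimensional ℂ E]

theorem continuous_bilin_self (B : E →ₗ[ℝ] E →ₗ[ℝ] ℝ) : Continuous fun z => B z z := by
  have : FiniteDimensional ℝ E := FiniteDimensional.complexToReal E
  have h1 : Continuous fun z => LinearMap.toContinuousLinearMap (B z) :=
    (LinearMap.toContinuousLinearMap.toLinearMap ∘ₗ B).continuous_of_finiteDimensional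
  exact h1.clm_apply continuous_id

theorem differentiable_bilin_self (q : E →ₗ[ℂ] E →ₗ[ℂ] ℂ) : Differentiable ℂ fun z => q z z := by
  have h1 : Differentiable ℂ fun z => LinearMap.toContinuousLinearMap (q z) :=
    (LinearMap.toContinuousLinearMap ((LinearMap.toContinuousLinearMap (𝕜 := ℂ) (E := E)
      (F' := ℂ)).toLinearMap ∘ₗ q)).differentiable
  exact h1.clm_apply differentiable_id

/-- If no complex hypersurface through the origin is contained in `{B ≥ 0}`, then functions
holomorphic in `{B < 0}` extend holomorphically to a neighbourhood of the origin. -/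
theorem exists_extension_neg (B : E →ₗ[ℝ] E →ₗ[ℝ] ℝ) (hB : ∀ x y, B x y = B y x) {Ω : Set E}
    (hΩ : IsOpen Ω) (h0 : 0 ∈ Ω) (hneg : ∃ z, B z z < 0)
    (hsupp : ∀ φ : E → ℂ, Differentiable ℂ φ → φ 0 = 0 → (¬ ∀ᶠ z in 𝓝 0, φ z = 0) →
      ∃ z, φ z = 0 ∧ B z z < 0) :
    ∃ U : Set E, IsOpen U ∧ 0 ∈ U ∧ ∀ f : E → ℂ, DifferentiableOn ℂ f {z | z ∈ Ω ∧ B z z < 0} →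
      ∃ F : E → ℂ, DifferentiableOn ℂ F U ∧ Set.EqOn F f (U ∩ {z | z ∈ Ω ∧ B z z < 0}) := by
  have hcont := continuous_bilin_self B
  -- it suffices to extend near one point of the negative side
  suffices hmain : ∃ v : E, (∀ ζ : ℂ, ζ ≠ 0 → B (ζ • v) (ζ • v) < 0) ∧
      ∃ U : Set E, IsOpen U ∧ Convex ℝ U ∧ 0 ∈ U ∧ U ⊆ Ω ∧ ∃ z₀ ∈ U, B z₀ z₀ < 0 ∧
      ∀ f : E → ℂ, DifferentiableOn ℂ f {z | z ∈ Ω ∧ B z z < 0} →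
        ∃ F : E → ℂ, DifferentiableOn ℂ F U ∧ F =ᶠ[𝓝 z₀] f by
    obtain ⟨v, hv, U, hUo, hUc, h0U, hUΩ, z₀, hz₀U, hz₀, hext⟩ := hmain
    refine ⟨U, hUo, h0U, fun f hf => ?_⟩
    obtain ⟨F, hF, hFf⟩ := hext f hf
    refine ⟨F, hF, ?_⟩
    have heq : U ∩ {z | z ∈ Ω ∧ B z z < 0} = U ∩ {z | B z z < 0} := by
      ext z
      exact ⟨fun h => ⟨h.1, h.2.2⟩, fun h => ⟨h.1, hUΩ h.1, h.2⟩⟩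
    have hDo : IsOpen (U ∩ {z | B z z < 0}) := hUo.inter (isOpen_lt hcont continuous_const)
    rw [heq]
    refine eqOn_of_eventuallyEq hDo (isPreconnected_inter_neg B hB hUo hUc h0U hv)
      (hF.mono Set.inter_subset_left) (hf.mono fun z hz => ⟨hUΩ hz.1, hz.2⟩) ⟨hz₀U, hz₀⟩ hFf
  -- a complex line in the negative side
  obtain ⟨v, hvq, hvB⟩ : ∃ v, complexPart B v v = 0 ∧ B v v = -1 := by
    obtain ⟨v, hvq, hvB⟩ : ∃ v, complexPart B v v = 0 ∧ B v v < 0 := by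
      by_cases hq : ∀ z, complexPart B z z = 0
      · obtain ⟨z, hz⟩ := hneg
        exact ⟨z, hq z, hz⟩
      · push Not at hq
        obtain ⟨z, hz⟩ := hq
        -- A nonzero `q` defines the complex quadric `q(z, z) = 0`, which must meet `{B < 0}`.
        refine hsupp _ (differentiable_bilin_self (complexPart B)) (by simp)
          (not_eventually_eq_zero_of_homogeneous (k := 2) (fun a z => ?_) hz)
        simp only [← Complex.coe_smul, map_smul, LinearMap.smul_apply, smul_eq_mul]
        ring
    set a : ℝ := (Real.sqrt (-B v v))⁻¹
    refine ⟨a • v, ?_, ?_⟩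
    · simp only [← Complex.coe_smul, map_smul, LinearMap.smul_apply, hvq, smul_zero]
    · simp only [map_smul, LinearMap.smul_apply, smul_eq_mul]
      have h1 : a * a = (-B v v)⁻¹ := by
        rw [← mul_inv, Real.mul_self_sqrt (by linarith)]
      rw [← mul_assoc, h1]
      have : B v v ≠ 0 := hvB.ne
      field_simp
  have hHv : hermitianPart B v = -1 := by
    have := apply_self_eq (B := B) v
    rw [hvq, hvB] at this
    simpa using this.symm
  have hvζ : ∀ ζ : ℂ, B (ζ • v) (ζ • v) = -‖ζ‖ ^ 2 := fun ζ => by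
    rw [apply_smul_self hB, hHv, hvq]; simp
  have hvneg : ∀ ζ : ℂ, ζ ≠ 0 → B (ζ • v) (ζ • v) < 0 := fun ζ hζ => by
    rw [hvζ]
    have := norm_pos_iff.2 hζ
    exact neg_lt_zero.2 (by positivity)
  refine ⟨v, hvneg, ?_⟩
  have hvI : B (Complex.I • v) (Complex.I • v) = -1 := by rw [hvζ]; simp
  have hvvI : B v (Complex.I • v) = 0 := by
    have := congrArg Complex.im hvq
    rw [complexPart_apply] at this
    simp only [hB (Complex.I • v) v, Complex.zero_im] at this
    linarith
  -- the form with the line split off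
  set c : E →ₗ[ℝ] ℂ := Complex.ofRealCLM.toLinearMap ∘ₗ B.flip v +
    Complex.I • (Complex.ofRealCLM.toLinearMap ∘ₗ B.flip (Complex.I • v)) with hc
  have hcz : ∀ z, c z = ⟨B z v, B z (Complex.I • v)⟩ := by
    intro z
    apply Complex.ext <;> simp [hc]
  have hcζ : ∀ ζ : ℂ, c (ζ • v) = -ζ := by
    intro ζ
    rw [hcz, smul_eq_re_add_im]
    apply Complex.ext <;>
      simp [hvB, hvI, hvvI, hB (Complex.I • v) v]
  set S : E →ₗ[ℝ] E →ₗ[ℝ] ℝ := B + (B.flip v).smulRight (B.flip v) +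
    (B.flip (Complex.I • v)).smulRight (B.flip (Complex.I • v)) with hSdef
  have hSxy : ∀ x y, S x y = B x y + B x v * B y v +
      B x (Complex.I • v) * B y (Complex.I • v) := fun x y => rfl
  have hSz : ∀ z, S z z = B z z + ‖c z‖ ^ 2 := by
    intro z
    rw [hSxy, hcz, Complex.sq_norm, Complex.normSq_mk]; ring
  have hSsymm : ∀ x y, S x y = S y x := fun x y => by
    rw [hSxy, hSxy, hB x y]; ring
  -- Completing the square: `S z z` is the maximum of `B` on the affine line `z + ℂ v`, attained at
  -- `ζ = c z`.
  have hexp : ∀ (z : E) (ζ : ℂ), B (z + ζ • v) (z + ζ • v) = S z z - ‖c z - ζ‖ ^ 2 := by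
    intro z ζ
    have e : B (z + ζ • v) (z + ζ • v) = B z z + 2 * B z (ζ • v) + B (ζ • v) (ζ • v) := by
      simp only [map_add, LinearMap.add_apply, hB (ζ • v) z]; ring
    rw [e, hvζ, smul_eq_re_add_im, hSxy, hcz, Complex.sq_norm, Complex.normSq_apply,
      Complex.sq_norm, Complex.normSq_apply]
    simp only [map_add, map_smul, smul_eq_mul, Complex.sub_re, Complex.sub_im]
    ring
  by_cases hpos : ∀ z, 0 ≤ S z z
  swap
  · push Not at hpos
    obtain ⟨w, hw⟩ := hpos
    refine exists_extension_of_discs hcont hΩ h0 hvneg (w := w) fun a ha ζ => ?_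
    rw [hexp]
    have : S (a • w) (a • w) = a ^ 2 * S w w := by
      simp only [map_smul, LinearMap.smul_apply, smul_eq_mul]; ring
    rw [this]
    have := mul_neg_of_pos_of_neg (pow_pos ha 2) hw
    nlinarith [sq_nonneg ‖c (a • w) - ζ‖]
  have hSv : ∀ (z : E) (ζ : ℂ), S (z + ζ • v) (z + ζ • v) = S z z := by
    intro z ζ
    rw [hSz, hexp, map_add, hcζ]
    rw [← sub_eq_add_neg]
    ring
  by_cases hline : ∀ w : E, ∃ b : ℂ, ∀ ζ : ℂ, 0 ≤ B (ζ • (w + b • v)) (ζ • (w + b • v))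
  · -- a complex hyperplane in `{B ≥ 0}`
    exfalso
    -- As `S` is invariant along `v`, `B ≥ 0` on `ℂ (w + b v)` reads `|c (ζ w) - ζ b|² ≤ S (ζ w) (ζ
    -- w)`. With one `μ` for all vectors, `ker μ` lies in `{B ≥ 0}`; and `μ v ≠ 0` because `S v v =
    -- 0` while `c v = -1`.
    obtain ⟨μ, hμ⟩ := exists_complexLinear_near S hSsymm hpos c fun w => by
      obtain ⟨b, hb⟩ := hline w
      refine ⟨b, fun ζ => ?_⟩
      have h1 := hSv (ζ • w) (ζ * b)
      have e : ζ • w + (ζ * b) • v = ζ • (w + b • v) := by rw [smul_add, smul_smul]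
      rw [e] at h1
      rw [← h1, hSz]
      have e2 : c (ζ • (w + b • v)) = c (ζ • w) - ζ * b := by
        rw [← e, map_add, hcζ]; ring
      rw [e2]
      linarith [hb ζ]
    have hμv : μ v ≠ 0 := by
      intro h
      have h1 := hμ v
      have h2 : c v = -1 := by simpa using hcζ 1
      rw [h, h2, hSz, h2, hvB] at h1
      norm_num at h1
    obtain ⟨z, hz, hz'⟩ := hsupp μ μ.toContinuousLinearMap.differentiable (map_zero μ)
      (not_eventually_eq_zero_of_homogeneous (k := 1) (fun a z => by
        rw [← Complex.coe_smul, map_smul, pow_one, smul_eq_mul]) hμv)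
    have := hμ z
    rw [hz, sub_zero, hSz] at this
    linarith
  push Not at hline
  obtain ⟨w, hw⟩ := hline
  have hwH : ∀ b : ℂ, hermitianPart B (w + b • v) < ‖complexPart B (w + b • v) (w + b • v)‖ :=
    fun b => (hw b).elim fun ζ h => hermitianPart_lt_of_neg hB h
  set q := complexPart B with hq
  have hqs : ∀ x y, q x y = q y x := complexPart_symm hB
  -- a vector on which the complex part takes a nonpositive real value is negative
  have hnegQ : ∀ z : E, hermitianPart B z < ‖q z z‖ → (q z z = -(‖q z z‖ : ℂ)) → B z z < 0 := by
    intro z hz hqz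
    rw [apply_self_eq, ← hq, hqz]
    simpa using hz
  -- Otherwise `q` is constant on `w + ℂ v`. Rotate by `d` until that value is `-|q|`: then `B = H -
  -- |q| < 0` on all of `d w + ℂ v`, including the point where `B` equals `S ≥ 0`.
  have hqvw : q v w ≠ 0 := by
    intro hvw
    have hQ : ∀ b : ℂ, q (w + b • v) (w + b • v) = q w w := by
      intro b
      simp only [map_add, map_smul, LinearMap.add_apply, LinearMap.smul_apply, hvw, hqs w v, hvq,
        smul_zero, add_zero]
    obtain ⟨d, hd⟩ : ∃ d : ℂ, ‖d‖ = 1 ∧ d ^ 2 * q w w = -(‖q w w‖ : ℂ) := by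
      obtain ⟨d, hd⟩ := IsSquare.exists_sq (-(starRingEnd ℂ) (q w w) / ‖q w w‖ : ℂ) (by
        obtain ⟨d, hd⟩ := IsAlgClosed.exists_pow_nat_eq
          (-(starRingEnd ℂ) (q w w) / ‖q w w‖ : ℂ) two_pos
        exact ⟨d, by rw [← hd, sq]⟩)
      rcases eq_or_ne (q w w) 0 with h | h
      · exact ⟨1, by simp, by simp [h]⟩
      · have hn : (‖q w w‖ : ℂ) ≠ 0 := by exact_mod_cast norm_ne_zero_iff.2 h
        refine ⟨d, ?_, ?_⟩
        · have h1 : ‖d‖ ^ 2 = 1 := by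
            rw [← norm_pow, ← hd, norm_div, norm_neg, RCLike.norm_conj]
            simp [h]
          exact (pow_eq_one_iff_of_nonneg (norm_nonneg d) two_ne_zero).1 h1
        · rw [← hd]
          have h1 : (starRingEnd ℂ) (q w w) * q w w = (‖q w w‖ : ℂ) ^ 2 := by
            rw [Complex.conj_mul']
          field_simp
          linear_combination -h1
    have hd0 : d ≠ 0 := fun h => by simp [h] at hd
    have h1 := hpos (d • w)
    have h2 := hexp (d • w) (c (d • w))
    rw [sub_self, norm_zero] at h2
    have e : d • w + c (d • w) • v = d • (w + (c (d • w) / d) • v) := by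
      rw [smul_add, smul_smul, mul_div_cancel₀ _ hd0]
    rw [e] at h2
    set b := c (d • w) / d
    have h3 : B (d • (w + b • v)) (d • (w + b • v)) < 0 := by
      rw [apply_smul_self hB, hd.1, ← hq, hQ, hd.2]
      have := hwH b
      rw [hQ] at this
      simpa using this
    rw [h2] at h3
    simp at h3
    linarith
  -- The shift `b₀` makes `w + b₀ v` isotropic for `q`, and division by `κ` normalises `q v u = 1 /
  -- 2`, so that `q` becomes `ζ η` on the plane.
  set κ : ℂ := 2 * q v w with hκ
  have hκ0 : κ ≠ 0 := mul_ne_zero two_ne_zero hqvw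
  set b₀ : ℂ := -(q w w / κ) with hb₀
  set u : E := κ⁻¹ • (w + b₀ • v) with hu
  have hvu : q v u = 1 / 2 := by
    simp only [hu, map_smul, map_add, hvq, smul_eq_mul, mul_zero, add_zero]
    rw [hκ]; field_simp
  have huu : q u u = 0 := by
    simp only [hu, map_smul, map_add, LinearMap.add_apply, LinearMap.smul_apply, hvq, smul_eq_mul,
      hqs w v]
    have : q v w = κ / 2 := by rw [hκ]; ring
    rw [this, hb₀]
    field_simp
    ring
  have hQζη : ∀ ζ η : ℂ, q (ζ • v + η • u) (ζ • v + η • u) = ζ * η := by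
    intro ζ η
    simp only [map_smul, map_add, LinearMap.add_apply, LinearMap.smul_apply, hvq, huu, smul_eq_mul,
      hqs u v, hvu]
    ring
  have hHu : ∀ ζ η : ℂ, η ≠ 0 → hermitianPart B (ζ • v + η • u) <
      ‖q (ζ • v + η • u) (ζ • v + η • u)‖ := by
    intro ζ η hη
    have e : ζ • v + η • u = (η * κ⁻¹) • (w + (b₀ + ζ * κ / η) • v) := by
      rw [hu, smul_smul, smul_add, smul_add, smul_smul, smul_smul]
      have : η * κ⁻¹ * (b₀ + ζ * κ / η) = η * κ⁻¹ * b₀ + ζ := by field_simp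
      rw [this, add_smul]
      abel
    have hne : η * κ⁻¹ ≠ 0 := mul_ne_zero hη (inv_ne_zero hκ0)
    rw [e, hermitianPart_smul hB, map_smul, map_smul, LinearMap.smul_apply, smul_smul, smul_eq_mul,
      norm_mul (η * κ⁻¹ * (η * κ⁻¹)), norm_mul (η * κ⁻¹) (η * κ⁻¹), ← sq]
    exact mul_lt_mul_of_pos_left (hwH _) (pow_pos (norm_pos_iff.2 hne) 2)
  -- The coordinates dual to `v`, `u` are `2 q(u, ·)` and `2 q(v, ·)`. Where `ζ η` is zero or a
  -- negative real and `η ≠ 0`, `B = H - |q| < 0`.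
  refine exists_extension_of_hyperbolas hcont hΩ h0 (u₁ := v) (u₂ := u)
    (l₁ := ((2 : ℂ) • q u).toContinuousLinearMap) (l₂ := ((2 : ℂ) • q v).toContinuousLinearMap)
    (by simp [hqs u v, hvu]) (by simp [huu]) (by simp [hvq]) (by simp [hvu]) hvneg
    (fun η hη => ?_) (fun ζ η t ht h => ?_)
  · have h1 := hHu 0 η hη
    have h2 := hQζη 0 η
    rw [zero_smul, zero_add] at h1 h2
    refine hnegQ _ h1 ?_
    rw [h2]; simp
  · have hη : η ≠ 0 := by
      rintro rfl
      rw [mul_zero] at h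
      have : t = 0 := by exact_mod_cast neg_eq_zero.1 h.symm
      exact ht.ne' this
    refine hnegQ _ (hHu ζ η hη) ?_
    rw [hQζη, h, norm_neg, Complex.norm_real, Real.norm_of_nonneg ht.le]

end SideExtension

/-! ### Initial forms of holomorphic germs and the obstruction to extension. -/

section InitialForm

variable {E : Type*} [NormedAddCommGroup E] [NormedSpace ℂ E]

/-- The Cauchy integral representing `t⁻ᵏ` times the remainder of order `k` in the expansion of `φ`
along the line through `z`. -/
def cauchyRemainder (φ : E → ℂ) (k : ℕ) (p : ℂ × E) : ℂ :=
  (2 * Real.pi * Complex.I)⁻¹ * ∮ s in C(0, 1), (s ^ k * (s - p.1))⁻¹ * φ (s • p.2)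

variable {φ : E → ℂ} {R : ℝ}

theorem smul_mem_ball_of_norm_le_one {s : ℂ} (hs : ‖s‖ ≤ 1) {z : E} (hz : z ∈ Metric.ball 0 R) :
    s • z ∈ Metric.ball 0 R := by
  rw [mem_ball_zero_iff] at hz ⊢
  rw [norm_smul]
  exact (mul_le_of_le_one_left (norm_nonneg _) hs).trans_lt hz

/-- Joint holomorphy, including at `t = 0`, makes the initial form a limit of rescalings of `φ`. -/
theorem differentiableOn_cauchyRemainder [FiniteDimensional ℂ E]
    (hφ : DifferentiableOn ℂ φ (Metric.ball 0 R)) (k : ℕ) :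
    DifferentiableOn ℂ (cauchyRemainder φ k) (Metric.ball 0 1 ×ˢ Metric.ball 0 R) := by
  set W : Set (ℂ × (ℂ × E)) := ({q | q.1 ≠ 0} ∩ {q | q.1 - q.2.1 ≠ 0}) ∩
    (fun q : ℂ × (ℂ × E) => q.1 • q.2.2) ⁻¹' Metric.ball 0 R
  have hWo : IsOpen W := ((isOpen_ne_fun (by fun_prop) continuous_const).inter
    (isOpen_ne_fun (by fun_prop) continuous_const)).inter
      (Metric.isOpen_ball.preimage (by fun_prop))
  have hG : DifferentiableOn ℂ (fun q : ℂ × (ℂ × E) =>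
      (q.1 ^ k * (q.1 - q.2.1))⁻¹ * φ (q.1 • q.2.2)) W := by
    refine DifferentiableOn.mul (DifferentiableOn.inv (by fun_prop) fun q hq => ?_) ?_
    · exact mul_ne_zero (pow_ne_zero _ hq.1.1) hq.1.2
    · exact hφ.comp (by fun_prop) fun q hq => hq.2
  refine (differentiableOn_circleIntegral hWo hG (Metric.isOpen_ball.prod Metric.isOpen_ball)
    zero_le_one ?_).const_mul _
  rintro s hs ⟨t, z⟩ ⟨ht, hz⟩
  have hs1 : ‖s‖ = 1 := by simpa using hs
  refine ⟨⟨ne_zero_of_mem_sphere one_ne_zero ⟨s, hs⟩, fun h => ?_⟩,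
    smul_mem_ball_of_norm_le_one hs1.le hz⟩
  have ht1 : ‖t‖ < 1 := by simpa using ht
  have hst : s = t := sub_eq_zero.1 h
  rw [← hst, hs1] at ht1
  exact lt_irrefl _ ht1

theorem differentiableOn_comp_smul (hφ : DifferentiableOn ℂ φ (Metric.ball 0 R)) {z : E}
    (hz : z ∈ Metric.ball 0 R) :
    DifferentiableOn ℂ (fun s : ℂ => φ (s • z)) (Metric.closedBall 0 1) := by
  refine hφ.comp (by fun_prop) fun s hs => smul_mem_ball_of_norm_le_one (by simpa using hs) hz

theorem cauchyRemainder_zero (hφ : DifferentiableOn ℂ φ (Metric.ball 0 R)) {t : ℂ} (ht : ‖t‖ < 1)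
    {z : E} (hz : z ∈ Metric.ball 0 R) : cauchyRemainder φ 0 (t, z) = φ (t • z) := by
  have := (differentiableOn_comp_smul hφ hz).circleIntegral_sub_inv_smul (w := t) (by simpa using ht)
  simp only [smul_eq_mul] at this
  simp only [cauchyRemainder, pow_zero, one_mul]
  rw [this, ← mul_assoc, inv_mul_cancel₀ Complex.two_pi_I_ne_zero, one_mul]

theorem continuousOn_cauchyRemainder_integrand (hφ : DifferentiableOn ℂ φ (Metric.ball 0 R)) {t : ℂ}
    (ht : ‖t‖ < 1) {z : E} (hz : z ∈ Metric.ball 0 R) (k : ℕ) :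
    ContinuousOn (fun s : ℂ => (s ^ k * (s - t))⁻¹ * φ (s • z)) (Metric.sphere 0 1) := by
  refine ContinuousOn.mul (ContinuousOn.inv₀ (by fun_prop) fun s hs => ?_)
    ((differentiableOn_comp_smul hφ hz).continuousOn.mono Metric.sphere_subset_closedBall)
  have hs1 : ‖s‖ = 1 := by simpa using hs
  refine mul_ne_zero (pow_ne_zero _ (ne_zero_of_mem_sphere one_ne_zero ⟨s, hs⟩)) fun h => ?_
  rw [← sub_eq_zero.1 h, hs1] at ht
  exact lt_irrefl _ ht

/-- Partial fractions: `1 / (sᵏ (s - t)) = 1 / sᵏ⁺¹ + t / (sᵏ⁺¹ (s - t))`. The value at `t = 0` is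
the coefficient of `tᵏ` in `φ (t z)`. -/
theorem cauchyRemainder_succ (hφ : DifferentiableOn ℂ φ (Metric.ball 0 R)) {t : ℂ} (ht : ‖t‖ < 1)
    {z : E} (hz : z ∈ Metric.ball 0 R) (k : ℕ) :
    cauchyRemainder φ k (t, z) =
      cauchyRemainder φ k (0, z) + t * cauchyRemainder φ (k + 1) (t, z) := by
  have h1 := (continuousOn_cauchyRemainder_integrand hφ (t := 0) (by simp) hz k).circleIntegrable
    zero_le_one
  have h2 := (continuousOn_cauchyRemainder_integrand hφ ht hz (k + 1)).circleIntegrable zero_le_one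
  have h3 : CircleIntegrable (fun s : ℂ => t * ((s ^ (k + 1) * (s - t))⁻¹ * φ (s • z))) 0 1 :=
    h2.const_smul (a := t)
  have h4 : (∮ s in C(0, 1), (s ^ k * (s - t))⁻¹ * φ (s • z)) =
      (∮ s in C(0, 1), (s ^ k * (s - 0))⁻¹ * φ (s • z)) +
        t * ∮ s in C(0, 1), (s ^ (k + 1) * (s - t))⁻¹ * φ (s • z) := by
    rw [← circleIntegral.integral_const_mul, ← circleIntegral.integral_add h1 h3]
    refine circleIntegral.integral_congr zero_le_one fun s hs => ?_
    have hs0 : s ≠ 0 := ne_zero_of_mem_sphere one_ne_zero ⟨s, hs⟩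
    have hst : s - t ≠ 0 := fun h => by
      have hs1 : ‖s‖ = 1 := by simpa using hs
      rw [← sub_eq_zero.1 h, hs1] at ht
      exact lt_irrefl _ ht
    simp only [sub_zero]
    field_simp
    ring
  simp only [cauchyRemainder]
  rw [h4]
  ring

theorem apply_smul_eq_pow_mul_cauchyRemainder (hφ : DifferentiableOn ℂ φ (Metric.ball 0 R)) {z : E}
    (hz : z ∈ Metric.ball 0 R) {k : ℕ} (hk : ∀ j < k, cauchyRemainder φ j (0, z) = 0) {t : ℂ}
    (ht : ‖t‖ < 1) : φ (t • z) = t ^ k * cauchyRemainder φ k (t, z) := by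
  induction k with
  | zero => rw [pow_zero, one_mul, cauchyRemainder_zero hφ ht hz]
  | succ k ih =>
    rw [ih fun j hj => hk j (hj.trans k.lt_succ_self), cauchyRemainder_succ hφ ht hz,
      hk k k.lt_succ_self, zero_add, pow_succ, mul_assoc]

/-- If all coefficients vanished, `φ (z / 2)` would be `2⁻ᵏ` times a remainder bounded uniformly in
`k`, because the contour is the unit circle. -/
theorem exists_cauchyRemainder_ne_zero (hφ : DifferentiableOn ℂ φ (Metric.ball 0 R)) (hR : 0 < R)
    (hne : ¬ ∀ᶠ z in 𝓝 0, φ z = 0) :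
    ∃ k, ∃ z ∈ Metric.ball (0 : E) R, cauchyRemainder φ k (0, z) ≠ 0 := by
  by_contra hall
  push Not at hall
  refine hne (Filter.eventually_of_mem (Metric.ball_mem_nhds 0 (half_pos hR)) fun y hy => ?_)
  set z : E := (2 : ℂ) • y with hzdef
  have hz : z ∈ Metric.ball (0 : E) R := by
    rw [mem_ball_zero_iff] at hy ⊢
    rw [hzdef, norm_smul, Complex.norm_ofNat]
    linarith
  have hyz : y = (1 / 2 : ℂ) • z := by rw [hzdef, smul_smul]; norm_num
  have ht : ‖(1 / 2 : ℂ)‖ < 1 := by norm_num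
  obtain ⟨C, hC⟩ := (isCompact_sphere (0 : ℂ) 1).exists_bound_of_continuousOn
    ((differentiableOn_comp_smul hφ hz).continuousOn.mono Metric.sphere_subset_closedBall)
  have hb : ∀ k, ‖φ y‖ ≤ (1 / 2) ^ k * (2 * C) := by
    intro k
    rw [hyz, apply_smul_eq_pow_mul_cauchyRemainder hφ hz (fun j _ => hall j z hz) ht, norm_mul,
      norm_pow]
    have h2 : ‖(1 / 2 : ℂ)‖ = 1 / 2 := by norm_num
    rw [h2]
    refine mul_le_mul_of_nonneg_left ?_ (by positivity)
    have := circleIntegral.norm_two_pi_i_inv_smul_integral_le_of_norm_le_const (c := 0)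
      (f := fun s : ℂ => (s ^ k * (s - 1 / 2))⁻¹ * φ (s • z)) (C := 2 * C) zero_le_one (by
        intro s hs
        have hs1 : ‖s‖ = 1 := by simpa using hs
        have hl : 1 / 2 ≤ ‖s - 1 / 2‖ := by
          have := norm_sub_norm_le s (1 / 2)
          rw [hs1, h2] at this
          linarith
        rw [norm_mul, norm_inv, norm_mul, norm_pow, hs1, one_pow, one_mul]
        refine mul_le_mul ?_ (hC s hs) (norm_nonneg _) (by norm_num)
        rw [inv_le_comm₀ (by linarith) two_pos]
        linarith)
    rwa [one_mul, smul_eq_mul] at this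
  have hlim : Filter.Tendsto (fun k : ℕ => (1 / 2 : ℝ) ^ k * (2 * C)) Filter.atTop (𝓝 0) := by
    simpa using (tendsto_pow_atTop_nhds_zero_of_lt_one (by norm_num) (by norm_num :
      (1 / 2 : ℝ) < 1)).mul_const (2 * C)
  exact norm_le_zero_iff.1 (ge_of_tendsto' hlim hb)

/-- If near the origin the zero set of a holomorphic germ lies in `{ρ ≥ 0}`, where `ρ` is homogeneous
of degree two, then so does the zero set of its initial form, which is an entire function. -/
theorem exists_entire_ne_zero [FiniteDimensional ℂ E] {ρ : E → ℝ} (hρ : Continuous ρ)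
    (hρs : ∀ (a : ℝ) z, ρ (a • z) = a ^ 2 * ρ z) (hφ : DifferentiableOn ℂ φ (Metric.ball 0 R))
    (hR : 0 < R) (hφ0 : φ 0 = 0) (hne : ¬ ∀ᶠ z in 𝓝 0, φ z = 0)
    (hsub : ∀ᶠ z in 𝓝 0, φ z = 0 → 0 ≤ ρ z) :
    ∃ Φ : E → ℂ, Differentiable ℂ Φ ∧ Φ 0 = 0 ∧ ∀ z, ρ z < 0 → Φ z ≠ 0 := by
  classical
  have hex := exists_cauchyRemainder_ne_zero hφ hR hne
  obtain ⟨k, hk, hmin⟩ : ∃ k, (∃ z ∈ Metric.ball (0 : E) R, cauchyRemainder φ k (0, z) ≠ 0) ∧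
      ∀ j < k, ∀ z ∈ Metric.ball (0 : E) R, cauchyRemainder φ j (0, z) = 0 := by
    refine ⟨Nat.find hex, Nat.find_spec hex, fun j hj z hz => ?_⟩
    have := Nat.find_min hex hj
    push Not at this
    exact this z hz
  obtain ⟨y, hy, hay⟩ := hk
  set N : Set E := Metric.ball 0 R with hN
  set Ψ := cauchyRemainder φ k with hΨ
  have hN0 : (0 : E) ∈ N := Metric.mem_ball_self hR
  have hΨd : DifferentiableOn ℂ Ψ (Metric.ball 0 1 ×ˢ N) := differentiableOn_cauchyRemainder hφ k
  have hopen : IsOpen ((Metric.ball (0 : ℂ) 1) ×ˢ N) := Metric.isOpen_ball.prod Metric.isOpen_ball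
  have hexp : ∀ z ∈ N, ∀ t : ℂ, ‖t‖ < 1 → φ (t • z) = t ^ k * Ψ (t, z) := fun z hz t ht =>
    apply_smul_eq_pow_mul_cauchyRemainder hφ hz (fun j hj => hmin j hj z hz) ht
  have hΨc : ∀ t : ℂ, ‖t‖ < 1 → ∀ z ∈ N, ContinuousAt Ψ (t, z) := fun t ht z hz =>
    (hΨd.differentiableAt (hopen.mem_nhds ⟨by simpa using ht, hz⟩)).continuousAt
  have hk0 : k ≠ 0 := by
    rintro rfl
    refine hay ?_
    rw [hΨ, cauchyRemainder_zero hφ (by simp) hy, zero_smul, hφ0]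
  -- Expand `φ (t c z)` once along `c z` and once along `z`, cancel `tᵏ` and let `t → 0`.
  have hhom : ∀ z ∈ N, ∀ c : ℂ, c • z ∈ N → Ψ (0, c • z) = c ^ k * Ψ (0, z) := by
    intro z hz c hcz
    have hl1 : Filter.Tendsto (fun t : ℂ => Ψ (t, c • z)) (𝓝[≠] 0) (𝓝 (Ψ (0, c • z))) := by
      have h1 : ContinuousAt (fun t : ℂ => Ψ (t, c • z)) 0 :=
        ContinuousAt.comp (f := fun t : ℂ => (t, c • z)) (hΨc 0 (by simp) _ hcz) (by fun_prop)
      exact h1.tendsto.mono_left nhdsWithin_le_nhds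
    have hl2 : Filter.Tendsto (fun t : ℂ => c ^ k * Ψ (t * c, z)) (𝓝[≠] 0)
        (𝓝 (c ^ k * Ψ (0, z))) := by
      have h1 : ContinuousAt (fun t : ℂ => Ψ (t * c, z)) 0 := by
        refine ContinuousAt.comp (x := (0 : ℂ)) (f := fun t : ℂ => (t * c, z)) (g := Ψ) ?_
          (by fun_prop)
        simpa only [zero_mul] using hΨc 0 (by simp) _ hz
      have := (h1.tendsto.mono_left (nhdsWithin_le_nhds (s := {0}ᶜ))).const_mul (c ^ k)
      simpa using this
    refine tendsto_nhds_unique hl1 (hl2.congr' ?_)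
    have e1 : ∀ᶠ t : ℂ in 𝓝 0, ‖t‖ < 1 := by
      have : ContinuousAt (fun t : ℂ => ‖t‖) 0 := by fun_prop
      exact this.eventually (gt_mem_nhds (by simp))
    have e2 : ∀ᶠ t : ℂ in 𝓝 0, ‖t * c‖ < 1 := by
      have : ContinuousAt (fun t : ℂ => ‖t * c‖) 0 := by fun_prop
      exact this.eventually (gt_mem_nhds (by simp))
    filter_upwards [nhdsWithin_le_nhds e1, nhdsWithin_le_nhds e2, self_mem_nhdsWithin]
      with t ht1 ht2 ht0
    have a1 := hexp _ hcz t ht1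
    have a2 := hexp _ hz (t * c) ht2
    rw [smul_smul, a2, mul_pow, mul_assoc] at a1
    exact mul_left_cancel₀ (pow_ne_zero k ht0) a1
  -- the global initial form
  set ε : E → ℂ := fun z => ((R / (2 * (‖z‖ + 1)) : ℝ) : ℂ) with hε
  have hεpos : ∀ z : E, 0 < R / (2 * (‖z‖ + 1)) := fun z => by positivity
  have hε0 : ∀ z, ε z ≠ 0 := fun z => by
    have := (hεpos z).ne'
    exact Complex.ofReal_ne_zero.2 this
  have hεN : ∀ z, ε z • z ∈ N := by
    intro z
    rw [hN, mem_ball_zero_iff, hε, Complex.coe_smul, norm_smul, Real.norm_of_nonneg (hεpos z).le]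
    have h1 := norm_nonneg z
    rw [div_mul_eq_mul_div, div_lt_iff₀ (by positivity)]
    nlinarith
  -- By homogeneity the scale does not matter, so near `z₀` the non-holomorphic `ε z` may be
  -- replaced by the constant `ε z₀`.
  have hΦ : ∀ z (c : ℂ), c ≠ 0 → c • z ∈ N →
      (ε z ^ k)⁻¹ * Ψ (0, ε z • z) = (c ^ k)⁻¹ * Ψ (0, c • z) := by
    intro z c hc hcz
    have e : c • z = (c / ε z) • (ε z • z) := by
      rw [smul_smul, div_mul_cancel₀ _ (hε0 z)]
    have h1 := hhom (ε z • z) (hεN z) (c / ε z) (e ▸ hcz)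
    rw [← e] at h1
    rw [h1, div_pow]
    have := hε0 z
    field_simp
  refine ⟨fun z => (ε z ^ k)⁻¹ * Ψ (0, ε z • z), fun z₀ => ?_, ?_, fun z₀ hz₀ hzero => ?_⟩
  · have hev : ∀ᶠ z in 𝓝 z₀, ε z₀ • z ∈ N := by
      have : ContinuousAt (fun z => ε z₀ • z) z₀ := by fun_prop
      exact this.eventually (Metric.isOpen_ball.mem_nhds (hεN z₀))
    have hd : DifferentiableAt ℂ (fun z => (ε z₀ ^ k)⁻¹ * Ψ (0, ε z₀ • z)) z₀ := by
      refine DifferentiableAt.const_mul ?_ _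
      exact DifferentiableAt.comp (f := fun z : E => ((0 : ℂ), ε z₀ • z)) z₀
        (hΨd.differentiableAt (hopen.mem_nhds ⟨by simp, hεN z₀⟩)) (by fun_prop)
    refine hd.congr_of_eventuallyEq ?_
    filter_upwards [hev] with z hz
    exact hΦ z (ε z₀) (hε0 z₀) hz
  · have h1 := hhom 0 hN0 0 (by simpa using hN0)
    rw [smul_zero, zero_pow hk0, zero_mul] at h1
    simp only [smul_zero, h1, mul_zero]
  set z₁ : E := ε z₀ • z₀ with hz₁
  have hz₁N : z₁ ∈ N := hεN z₀
  have haz₁ : Ψ (0, z₁) = 0 :=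
    (mul_eq_zero.1 hzero).resolve_left (inv_ne_zero (pow_ne_zero k (hε0 z₀)))
  have hρz₁ : ρ z₁ < 0 := by
    rw [hz₁, hε, Complex.coe_smul, hρs]
    exact mul_neg_of_pos_of_neg (pow_pos (hεpos z₀) 2) hz₀
  -- On the line from the supposed zero `z₁` towards `y`, where the initial form is nonzero, that
  -- zero is isolated.
  set d : E := y - z₁ with hd
  set L : Set ℂ := {s : ℂ | z₁ + s • d ∈ N} with hL
  have hLo : IsOpen L := Metric.isOpen_ball.preimage (by fun_prop : Continuous fun s : ℂ => z₁ + s • d)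
  have hLc : IsPreconnected L := isPreconnected_line_inter_ball z₁ d 0 R
  have h0L : (0 : ℂ) ∈ L := by
    show z₁ + (0 : ℂ) • d ∈ N
    simpa using hz₁N
  have h1L : (1 : ℂ) ∈ L := by
    show z₁ + (1 : ℂ) • d ∈ N
    simpa [hd] using hy
  have hline : ∀ t : ℂ, ‖t‖ < 1 → DifferentiableOn ℂ (fun s : ℂ => Ψ (t, z₁ + s • d)) L := by
    intro t ht s hs
    exact (DifferentiableAt.comp (f := fun s : ℂ => (t, z₁ + s • d)) s
      (hΨd.differentiableAt (hopen.mem_nhds ⟨by simpa using ht, hs⟩))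
      (by fun_prop)).differentiableWithinAt
  set h : ℂ → ℂ := fun s => Ψ (0, z₁ + s • d) with hh
  have hha : AnalyticOnNhd ℂ h L := (hline 0 (by simp)).analyticOnNhd hLo
  have hh0 : h 0 = 0 := by simp [hh, haz₁]
  have hh1 : h 1 ≠ 0 := by simpa [hh, hd] using hay
  have hev1 : ∀ᶠ s in 𝓝 (0 : ℂ), s ≠ 0 → h s ≠ 0 := by
    rcases (hha 0 h0L).eventually_eq_zero_or_eventually_ne_zero with h2 | h2
    · exact absurd (hha.eqOn_zero_of_preconnected_of_eventuallyEq_zero hLc h0L h2 h1L) hh1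
    · exact eventually_nhdsWithin_iff.1 h2
  have hev2 : ∀ᶠ s in 𝓝 (0 : ℂ), ρ (z₁ + s • d) < 0 := by
    have hc : ContinuousAt (fun s : ℂ => ρ (z₁ + s • d)) 0 := by fun_prop
    refine hc.eventually (gt_mem_nhds ?_)
    simpa using hρz₁
  obtain ⟨δ, hδ, hδ'⟩ := Metric.nhds_basis_closedBall.eventually_iff.1
    ((hev1.and hev2).and (hLo.mem_nhds h0L))
  have hδL : Metric.closedBall (0 : ℂ) δ ⊆ L := fun s hs => (hδ' hs).2
  obtain ⟨m, hm, hmh⟩ : ∃ m > 0, ∀ s ∈ Metric.sphere (0 : ℂ) δ, m ≤ ‖h s‖ := by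
    have hcont : ContinuousOn (fun s => ‖h s‖) (Metric.sphere (0 : ℂ) δ) :=
      (hha.continuousOn.mono (Metric.sphere_subset_closedBall.trans hδL)).norm
    obtain ⟨s₀, hs₀, hs₀'⟩ := (isCompact_sphere (0 : ℂ) δ).exists_isMinOn
      (NormedSpace.sphere_nonempty.2 hδ.le) hcont
    exact ⟨‖h s₀‖, norm_pos_iff.2 ((hδ' (Metric.sphere_subset_closedBall hs₀)).1.1
      (ne_zero_of_mem_sphere hδ.ne' ⟨s₀, hs₀⟩)), fun s hs => hs₀' hs⟩
  have hev3 : ∀ᶠ t : ℂ in 𝓝 0, ∀ s ∈ Metric.closedBall (0 : ℂ) δ,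
      ‖Ψ (t, z₁ + s • d) - h s‖ < m / 4 := by
    refine (isCompact_closedBall _ _).eventually_forall_of_forall_eventually fun s hs => ?_
    have hc1 : ContinuousAt (fun q : ℂ × ℂ => Ψ (q.1, z₁ + q.2 • d)) (0, s) :=
      ContinuousAt.comp (x := ((0 : ℂ), s)) (f := fun q : ℂ × ℂ => (q.1, z₁ + q.2 • d))
        (hΨc 0 (by simp) _ (hδL hs)) (by fun_prop)
    have hc2 : ContinuousAt (fun q : ℂ × ℂ => h q.2) (0, s) :=
      ContinuousAt.comp (x := ((0 : ℂ), s)) (f := Prod.snd) (hha s (hδL hs)).continuousAt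
        continuousAt_snd
    refine (hc1.sub hc2).norm.eventually (gt_mem_nhds ?_)
    show ‖Ψ (0, z₁ + s • d) - Ψ (0, z₁ + s • d)‖ < m / 4
    rw [sub_self, norm_zero]
    positivity
  obtain ⟨η, hη, hη'⟩ := Metric.eventually_nhds_iff_ball.1 hsub
  obtain ⟨τ, hτ, hτ'⟩ := Metric.eventually_nhds_iff_ball.1 hev3
  -- Small enough for `Ψ (a, ·)` to be close to the initial form, and for `a • N` to lie in the ball
  -- where the zeros of `φ` are controlled.
  obtain ⟨a, ha0, haτ, ha1, haη⟩ : ∃ a : ℝ, 0 < a ∧ a < τ ∧ a < 1 ∧ a * R ≤ η := by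
    refine ⟨min (τ / 2) (min (1 / 2) (η / R)), by positivity, ?_, ?_, ?_⟩
    · exact (min_le_left _ _).trans_lt (by linarith)
    · exact ((min_le_right _ _).trans (min_le_left _ _)).trans_lt (by norm_num)
    · rw [← le_div_iff₀ hR]
      exact (min_le_right _ _).trans (min_le_right _ _)
  have hna : ‖(a : ℂ)‖ = a := by rw [Complex.norm_real, Real.norm_of_nonneg ha0.le]
  have ha1' : ‖(a : ℂ)‖ < 1 := by rw [hna]; exact ha1
  have hclose := hτ' (a : ℂ) (by rw [mem_ball_zero_iff, hna]; exact haτ)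
  set g : ℂ → ℂ := fun s => Ψ (a, z₁ + s • d) with hg
  -- Hurwitz by the maximum principle for `1 / g`: without zeros, `‖g‖ ≥ m / 2` on the circle would
  -- persist at the centre, where `‖g 0‖ < m / 4`. The zero found is a zero of `φ`, after scaling by
  -- `a`, in `{ρ < 0}`.
  obtain ⟨s, hs, hgs⟩ : ∃ s ∈ Metric.closedBall (0 : ℂ) δ, g s = 0 := by
    by_contra hno
    push Not at hno
    have hgd : DiffContOnCl ℂ (fun s => (g s)⁻¹) (Metric.ball 0 δ) := by
      refine DifferentiableOn.diffContOnCl ?_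
      rw [closure_ball _ hδ.ne']
      exact ((hline a ha1').mono hδL).inv hno
    have hbound := Complex.norm_le_of_forall_mem_frontier_norm_le Metric.isBounded_ball hgd
      (C := (m / 2)⁻¹) (fun s hs => by
        rw [frontier_ball _ hδ.ne'] at hs
        rw [norm_inv]
        refine inv_anti₀ (by positivity) ?_
        have h1 := hmh s hs
        have h2 := hclose s (Metric.sphere_subset_closedBall hs)
        have h3 := norm_sub_norm_le (h s) (g s)
        rw [norm_sub_rev] at h3
        have h4 : ‖g s - h s‖ < m / 4 := h2
        linarith) (subset_closure (Metric.mem_ball_self hδ) : (0 : ℂ) ∈ _)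
    have h2 : ‖g 0 - h 0‖ < m / 4 := hclose 0 (Metric.mem_closedBall_self hδ.le)
    rw [hh0, sub_zero] at h2
    rw [norm_inv] at hbound
    have h3 := norm_pos_iff.2 (hno 0 (Metric.mem_closedBall_self hδ.le))
    have h4 := (inv_le_inv₀ h3 (by positivity)).1 hbound
    linarith
  have hsN : z₁ + s • d ∈ N := hδL hs
  have hzero' : φ ((a : ℂ) • (z₁ + s • d)) = 0 := by
    rw [hexp _ hsN _ ha1']
    have : Ψ ((a : ℂ), z₁ + s • d) = 0 := hgs
    rw [this, mul_zero]
  have hball : (a : ℂ) • (z₁ + s • d) ∈ Metric.ball (0 : E) η := by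
    rw [mem_ball_zero_iff, norm_smul, hna]
    have : ‖z₁ + s • d‖ < R := by simpa [hN] using hsN
    exact (mul_lt_mul_of_pos_left this ha0).trans_le haη
  have hfin := hη' _ hball hzero'
  rw [Complex.coe_smul, hρs] at hfin
  have := mul_neg_of_pos_of_neg (pow_pos ha0 2) (hδ' hs).1.2
  linarith

/-- An entire function which vanishes at the origin and has no zeros in `{ρ < 0}` obstructs
holomorphic extension from `{ρ < 0}` across the origin. -/
theorem not_forall_extends {ρ : E → ℝ} (hρs : ∀ (a : ℝ) z, ρ (a • z) = a ^ 2 * ρ z)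
    (hneg : ∃ z, ρ z < 0) {Φ : E → ℂ} (hΦ : Differentiable ℂ Φ) (hΦ0 : Φ 0 = 0)
    (hΦne : ∀ z, ρ z < 0 → Φ z ≠ 0) {Ω U : Set E} (hΩ : IsOpen Ω) (h0 : 0 ∈ Ω) (hU : IsOpen U)
    (h0U : 0 ∈ U) :
    ¬ ∀ f : E → ℂ, DifferentiableOn ℂ f {z | z ∈ Ω ∧ ρ z < 0} →
      ∃ F : E → ℂ, DifferentiableOn ℂ F U ∧ Set.EqOn F f (U ∩ {z | z ∈ Ω ∧ ρ z < 0}) := by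
  intro hall
  -- Along a ray in `{ρ < 0}` the product `F Φ` is `1`, yet it tends to `F 0 * Φ 0 = 0`.
  obtain ⟨F, hF, hFeq⟩ := hall (fun z => (Φ z)⁻¹)
    (hΦ.differentiableOn.inv fun z hz => hΦne z hz.2)
  obtain ⟨z, hz⟩ := hneg
  have hc : Filter.Tendsto (fun a : ℝ => a • z) (𝓝[>] 0) (𝓝 0) := by
    have : Continuous fun a : ℝ => a • z := by fun_prop
    simpa using (this.tendsto 0).mono_left nhdsWithin_le_nhds
  have hFc : ContinuousAt F 0 := (hF.differentiableAt (hU.mem_nhds h0U)).continuousAt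
  have hprod : Filter.Tendsto (fun a : ℝ => F (a • z) * Φ (a • z)) (𝓝[>] 0) (𝓝 (F 0 * Φ 0)) :=
    (hFc.tendsto.comp hc).mul ((hΦ 0).continuousAt.tendsto.comp hc)
  have hone : ∀ᶠ a : ℝ in 𝓝[>] 0, F (a • z) * Φ (a • z) = 1 := by
    filter_upwards [hc.eventually (hU.mem_nhds h0U), hc.eventually (hΩ.mem_nhds h0),
      self_mem_nhdsWithin] with a haU haΩ ha
    have hneg : ρ (a • z) < 0 := by
      rw [hρs]
      exact mul_neg_of_pos_of_neg (pow_pos ha 2) hz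
    rw [hFeq ⟨haU, haΩ, hneg⟩]
    exact inv_mul_cancel₀ (hΦne _ hneg)
  have := tendsto_nhds_unique (hprod.congr' hone) tendsto_const_nhds
  rw [hΦ0, mul_zero] at this
  exact zero_ne_one this

end InitialForm

/-! ### Quadratic polynomials as symmetric bilinear forms. -/

section RealPolynomials

open MvPolynomial in
theorem pderiv_comm {σ R : Type*} [CommRing R] (i j : σ) (p : MvPolynomial σ R) :
    pderiv i (pderiv j p) = pderiv j (pderiv i p) := by
  classical
  have h : ⁅(pderiv i : Derivation R (MvPolynomial σ R) (MvPolynomial σ R)),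
      (pderiv j : Derivation R (MvPolynomial σ R) (MvPolynomial σ R))⁆ = 0 := by
    refine MvPolynomial.derivation_ext fun k => ?_
    rw [Derivation.commutator_apply]
    simp only [pderiv_X, Derivation.zero_apply, Pi.single_apply]
    split_ifs <;> simp
  have := congrArg (fun D => D p) h
  simp only [Derivation.commutator_apply, Derivation.zero_apply] at this
  exact sub_eq_zero.1 this

variable {n : ℕ}

theorem realCoords_add (x y : Cn n) : realCoords (x + y) = realCoords x + realCoords y := by
  funext i; cases i <;> simp [realCoords]

theorem realCoords_smul (a : ℝ) (x : Cn n) : realCoords (a • x) = a • realCoords x := by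
  funext i; cases i <;> simp [realCoords]

theorem exists_realCoords_eq (t : Fin n ⊕ Fin n → ℝ) : ∃ z : Cn n, realCoords z = t :=
  ⟨WithLp.toLp 2 fun j => ⟨t (Sum.inl j), t (Sum.inr j)⟩, by
    funext i; cases i <;> simp [realCoords]⟩

/-- The function of a homogeneous polynomial of degree two is a quadratic form, and the partial
derivatives are given by the polar form. -/
theorem exists_bilin_of_isHomogeneous {ρ : RealPoly n} (hρ : ρ.IsHomogeneous 2) :
    ∃ B : Cn n →ₗ[ℝ] Cn n →ₗ[ℝ] ℝ, (∀ x y, B x y = B y x) ∧ (∀ z, polyFun ρ z = B z z) ∧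
      ∀ z i, ∃ y, polyFun (MvPolynomial.pderiv i ρ) z = B z y := by
  set h : Fin n ⊕ Fin n → Fin n ⊕ Fin n → ℝ := fun i j =>
    MvPolynomial.coeff 0 (MvPolynomial.pderiv j (MvPolynomial.pderiv i ρ)) with hh
  have hsymm : ∀ i j, h i j = h j i := fun i j => by rw [hh]; simp only [pderiv_comm i j]
  have hconst : ∀ i j, MvPolynomial.pderiv j (MvPolynomial.pderiv i ρ) = MvPolynomial.C (h i j) := by
    intro i j
    have h0 : (MvPolynomial.pderiv j (MvPolynomial.pderiv i ρ)).IsHomogeneous 0 :=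
      (hρ.pderiv (i := i)).pderiv (i := j)
    exact MvPolynomial.totalDegree_eq_zero_iff_eq_C.1 (Nat.le_zero.1 h0.totalDegree_le)
  -- Euler's identity in degree one here, and in degree two for `hquad`, recovers `ρ` from its
  -- constant Hessian `h`.
  have hlin : ∀ z i, polyFun (MvPolynomial.pderiv i ρ) z = ∑ j, h i j * realCoords z j := by
    intro z i
    have e := congrArg (MvPolynomial.eval (realCoords z)) (hρ.pderiv (i := i)).sum_X_mul_pderiv
    simp only [map_sum, map_mul, MvPolynomial.eval_X, hconst, MvPolynomial.eval_C] at e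
    simp only [Nat.add_one_sub_one, one_smul] at e
    rw [polyFun, ← e]
    exact Finset.sum_congr rfl fun j _ => mul_comm _ _
  have hquad : ∀ z, 2 * polyFun ρ z = ∑ i, realCoords z i * ∑ j, h i j * realCoords z j := by
    intro z
    have e := congrArg (MvPolynomial.eval (realCoords z)) hρ.sum_X_mul_pderiv
    simp only [map_sum, map_mul, MvPolynomial.eval_X, map_nsmul] at e
    rw [nsmul_eq_mul] at e
    rw [polyFun, show (2 : ℝ) = ((2 : ℕ) : ℝ) by norm_num, ← e]
    exact Finset.sum_congr rfl fun i _ => by rw [← hlin]; rfl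
  refine ⟨LinearMap.mk₂ ℝ (fun x y => (∑ i, realCoords y i * ∑ j, h i j * realCoords x j) / 2)
    ?_ ?_ ?_ ?_, ?_, ?_, ?_⟩
  · intro x x' y
    simp only [realCoords_add, Pi.add_apply, mul_add, Finset.sum_add_distrib, add_div]
  · intro a x y
    simp only [realCoords_smul, Pi.smul_apply, smul_eq_mul, Finset.mul_sum, ← mul_div_assoc]
    congr 1
    exact Finset.sum_congr rfl fun i _ => Finset.sum_congr rfl fun j _ => by ring
  · intro x y y'
    simp only [realCoords_add, Pi.add_apply, add_mul, Finset.sum_add_distrib, add_div]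
  · intro a x y
    simp only [realCoords_smul, Pi.smul_apply, smul_eq_mul, Finset.mul_sum, ← mul_div_assoc]
    congr 1
    exact Finset.sum_congr rfl fun i _ => Finset.sum_congr rfl fun j _ => by ring
  · intro x y
    simp only [LinearMap.mk₂_apply, Finset.mul_sum]
    rw [Finset.sum_comm]
    congr 1
    refine Finset.sum_congr rfl fun i _ => Finset.sum_congr rfl fun j _ => ?_
    rw [hsymm]; ring
  · intro z
    rw [LinearMap.mk₂_apply, ← hquad]; ring
  · intro z i
    -- The entry `2` compensates the factor `1 / 2` in the polar form.
    obtain ⟨y, hy⟩ := exists_realCoords_eq (Pi.single i (2 : ℝ))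
    refine ⟨y, ?_⟩
    rw [LinearMap.mk₂_apply, hlin, hy,
      Finset.sum_eq_single (f := fun k => (Pi.single i 2 : _ → ℝ) k * _) i]
    · rw [Pi.single_eq_same]; ring
    · intro j _ hj
      rw [Pi.single_eq_of_ne hj, zero_mul]
    · simp

end RealPolynomials

/-! ### Indefinite forms, closures of the two sides, and hypersurfaces against extension. -/

section Cones

/-- An isotropic vector of a positive semidefinite form lies in its radical. -/
theorem exists_neg_of_apply_ne_zero {E : Type*} [AddCommGroup E] [Module ℝ E]
    (B : E →ₗ[ℝ] E →ₗ[ℝ] ℝ) (hB : ∀ x y, B x y = B y x) {z y : E} (hz : B z z = 0)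
    (hy : B z y ≠ 0) : ∃ x, B x x < 0 := by
  by_contra hno
  push Not at hno
  have key : ∀ t : ℝ, 0 ≤ 2 * t * B z y + t ^ 2 * B y y := by
    intro t
    have := hno (z + t • y)
    simp only [map_add, map_smul, LinearMap.add_apply, LinearMap.smul_apply, smul_eq_mul, hz,
      hB y z] at this
    linarith
  have hyy : 0 ≤ B y y := hno y
  -- Nearly the minimiser; the added `1` keeps the denominator positive when `B y y = 0`.
  have h1 := key (-(B z y) / (B y y + 1))
  have hpos : 0 < B y y + 1 := by linarith
  have h2 : 2 * (-(B z y) / (B y y + 1)) * B z y + (-(B z y) / (B y y + 1)) ^ 2 * B y y =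
      -((B z y) ^ 2 * (B y y + 2)) / (B y y + 1) ^ 2 := by
    field_simp
    ring
  rw [h2] at h1
  have h3 : 0 < (B z y) ^ 2 * (B y y + 2) := mul_pos (by positivity) (by linarith)
  have h4 := div_neg_of_neg_of_pos (neg_lt_zero.2 h3) (by positivity : 0 < (B y y + 1) ^ 2)
  linarith

/-- With the sign of `v` chosen so that `B z v ≤ 0`, every small positive step along `v` lands in
the negative side, at singular points of the cone too. -/
theorem mem_closure_neg {E : Type*} [NormedAddCommGroup E] [NormedSpace ℝ E]
    (B : E →ₗ[ℝ] E →ₗ[ℝ] ℝ) (hB : ∀ x y, B x y = B y x) (hneg : ∃ x, B x x < 0) {Ω : Set E}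
    (hΩ : IsOpen Ω) {z : E} (hz : z ∈ Ω) (hzB : B z z ≤ 0) :
    z ∈ closure {z | z ∈ Ω ∧ B z z < 0} := by
  obtain ⟨v, hv, hzv⟩ : ∃ v, B v v < 0 ∧ B z v ≤ 0 := by
    obtain ⟨v, hv⟩ := hneg
    rcases le_total (B z v) 0 with h | h
    · exact ⟨v, hv, h⟩
    · exact ⟨-v, by simpa using hv, by simpa using h⟩
  have hc : Filter.Tendsto (fun t : ℝ => z + t • v) (𝓝[>] 0) (𝓝 z) := by
    have : Continuous fun t : ℝ => z + t • v := by fun_prop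
    simpa using (this.tendsto 0).mono_left nhdsWithin_le_nhds
  refine mem_closure_of_tendsto hc ?_
  filter_upwards [hc.eventually (hΩ.mem_nhds hz), self_mem_nhdsWithin] with t htΩ ht
  refine ⟨htΩ, ?_⟩
  have ht0 : 0 < t := ht
  simp only [map_add, map_smul, LinearMap.add_apply, LinearMap.smul_apply, smul_eq_mul, hB v z]
  have h1 := mul_neg_of_pos_of_neg (mul_pos ht0 ht0) hv
  have h2 := mul_nonpos_of_nonneg_of_nonpos ht0.le hzv
  nlinarith

variable {n : ℕ}

/-- A complex hypersurface in `{B ≥ 0}` prevents holomorphic extension from `{B < 0}`. -/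
theorem not_allExtendTo_of_hypersurface (B : Cn n →ₗ[ℝ] Cn n →ₗ[ℝ] ℝ) (hneg : ∃ z, B z z < 0)
    {A : Set (Cn n)} (hA : IsComplexHypersurfaceAt A 0) (hAB : GermSubset 0 A {z | 0 ≤ B z z})
    {Ω U : Set (Cn n)} (hΩ : IsOpen Ω) (h0 : 0 ∈ Ω) (hU : IsOpen U) (h0U : 0 ∈ U) :
    ¬ AllExtendTo {z | z ∈ Ω ∧ B z z < 0} U := by
  obtain ⟨V, hVo, h0V, φ, hφ, hφ0, hne, hAV⟩ := hA
  obtain ⟨R, hR, hRV⟩ := Metric.isOpen_iff.1 hVo 0 h0V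
  have hs : ∀ (a : ℝ) z, B (a • z) (a • z) = a ^ 2 * B z z := fun a z => by
    simp only [map_smul, LinearMap.smul_apply, smul_eq_mul]; ring
  have hsub : ∀ᶠ z in 𝓝 (0 : Cn n), φ z = 0 → 0 ≤ B z z := by
    filter_upwards [hAB, hVo.mem_nhds h0V] with z hz hzV hφz
    have : z ∈ A ∩ V := by rw [hAV]; exact ⟨hzV, hφz⟩
    exact hz this.1
  obtain ⟨Φ, hΦ, hΦ0, hΦne⟩ := exists_entire_ne_zero (ρ := fun z => B z z)
    (continuous_bilin_self B) hs (hφ.mono hRV) hR hφ0 hne hsub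
  exact not_forall_extends hs hneg hΦ hΦ0 hΦne hΩ h0 hU h0U

/-- If holomorphic functions do not extend from `{B < 0}`, then a complex hypersurface is contained
in the closure of `{B > 0}`. -/
theorem exists_hypersurface_of_not_allExtendTo (B : Cn n →ₗ[ℝ] Cn n →ₗ[ℝ] ℝ)
    (hB : ∀ x y, B x y = B y x) (hneg : ∃ z, B z z < 0) (hpos : ∃ z, 0 < B z z) {Ω : Set (Cn n)}
    (hΩ : IsOpen Ω) (h0 : 0 ∈ Ω)
    (hno : ¬ ∃ U : Set (Cn n), IsOpen U ∧ 0 ∈ U ∧ AllExtendTo {z | z ∈ Ω ∧ B z z < 0} U) :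
    ∃ A, IsComplexHypersurfaceAt A 0 ∧ GermSubset 0 A (closure {z | z ∈ Ω ∧ 0 < B z z}) := by
  have hφ : ∃ φ : Cn n → ℂ, Differentiable ℂ φ ∧ φ 0 = 0 ∧ (¬ ∀ᶠ z in 𝓝 0, φ z = 0) ∧
      ∀ z, φ z = 0 → 0 ≤ B z z := by
    by_contra hall
    refine hno (exists_extension_neg B hB hΩ h0 hneg fun φ h1 h2 h3 => ?_)
    by_contra h4
    push Not at h4
    exact hall ⟨φ, h1, h2, h3, h4⟩
  obtain ⟨φ, hφ, hφ0, hne, hsub⟩ := hφ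
  refine ⟨{z | φ z = 0}, ⟨Set.univ, isOpen_univ, trivial, φ, hφ.differentiableOn, hφ0, hne, ?_⟩, ?_⟩
  · ext z; simp
  · filter_upwards [hΩ.mem_nhds h0] with z hzΩ hz
    have := mem_closure_neg (-B) (fun x y => by simp [hB x y])
      (hpos.imp fun x hx => by simpa using hx) hΩ hzΩ (by simpa using hsub z hz)
    simpa using this

end Cones

end QuadCone

end

theorem theorem1 (n : ℕ) (hn : 1 < n) (ρ : QuadCone.RealPoly n)
    (hρ : QuadCone.IsQuadraticCone ρ)
    (Ω : Set (QuadCone.Cn n)) (hΩ : IsOpen Ω) (h0 : (0 : QuadCone.Cn n) ∈ Ω) :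
    (¬ QuadCone.HasTwoSidedSupport (QuadCone.polyFun ρ) Ω 0) ↔
      ∃ U : Set (QuadCone.Cn n), IsOpen U ∧ (0 : QuadCone.Cn n) ∈ U ∧
        (QuadCone.AllExtendTo (QuadCone.posSide (QuadCone.polyFun ρ) Ω) U ∨
          QuadCone.AllExtendTo (QuadCone.negSide (QuadCone.polyFun ρ) Ω) U) := by
  obtain ⟨B, hB, hρB, hder⟩ := QuadCone.exists_bilin_of_isHomogeneous hρ.homogeneous
  obtain ⟨z, hz, i, hi⟩ := hρ.differential_ne_zero
  obtain ⟨y, hy⟩ := hder z i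
  have hzB : B z z = 0 := by rw [← hρB]; exact hz
  rw [hy] at hi
  have hB' : ∀ x y, (-B) x y = (-B) y x := fun x y => by simp [hB x y]
  -- A zero of `ρ` with nonzero differential makes `B` indefinite, so the one-sided results apply to
  -- both `B` and `-B`.
  have hneg : ∃ x, B x x < 0 := QuadCone.exists_neg_of_apply_ne_zero B hB hzB hi
  have hneg' : ∃ x, (-B) x x < 0 :=
    QuadCone.exists_neg_of_apply_ne_zero (-B) hB' (by simpa using hzB) (by simpa using hi)
  have hN : QuadCone.negSide (QuadCone.polyFun ρ) Ω = {z | z ∈ Ω ∧ B z z < 0} := by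
    ext z; simp [QuadCone.negSide, hρB]
  have hN' : QuadCone.negSide (QuadCone.polyFun ρ) Ω = {z | z ∈ Ω ∧ 0 < (-B) z z} := by
    ext z; simp [QuadCone.negSide, hρB]
  have hP : QuadCone.posSide (QuadCone.polyFun ρ) Ω = {z | z ∈ Ω ∧ 0 < B z z} := by
    ext z; simp [QuadCone.posSide, hρB]
  have hP' : QuadCone.posSide (QuadCone.polyFun ρ) Ω = {z | z ∈ Ω ∧ (-B) z z < 0} := by
    ext z; simp [QuadCone.posSide, hρB]
  constructor
  · intro hsupp
    by_contra hno
    obtain ⟨A, hA, hAs⟩ := QuadCone.exists_hypersurface_of_not_allExtendTo B hB hneg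
      (hneg'.imp fun x hx => by simpa using hx) hΩ h0 (by
        rintro ⟨U, hU, h0U, hext⟩
        exact hno ⟨U, hU, h0U, Or.inr (hN ▸ hext)⟩)
    obtain ⟨A', hA', hAs'⟩ := QuadCone.exists_hypersurface_of_not_allExtendTo (-B) hB' hneg'
      (hneg.imp fun x hx => by simpa using hx) hΩ h0 (by
        rintro ⟨U, hU, h0U, hext⟩
        exact hno ⟨U, hU, h0U, Or.inl (hP' ▸ hext)⟩)
    exact hsupp ⟨A, A', hA, hA', hP ▸ hAs, hN' ▸ hAs'⟩
  · rintro ⟨U, hU, h0U, hext⟩ ⟨A, A', hA, hA', hAs, hAs'⟩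
    have hcont := QuadCone.continuous_bilin_self B
    rcases hext with hext | hext
    · rw [hP'] at hext
      refine QuadCone.not_allExtendTo_of_hypersurface (-B) hneg' hA' ?_ hΩ h0 hU h0U hext
      refine hAs'.mono fun z hz hzA => ?_
      have hcl : closure (QuadCone.negSide (QuadCone.polyFun ρ) Ω) ⊆ {z | B z z ≤ 0} := by
        rw [hN]
        exact closure_minimal (fun z hz => hz.2.le) (isClosed_le hcont continuous_const)
      have : B z z ≤ 0 := hcl (hz hzA)
      simpa using this
    · rw [hN] at hext
      refine QuadCone.not_allExtendTo_of_hypersurface B hneg hA ?_ hΩ h0 hU h0U hext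
      refine hAs.mono fun z hz hzA => ?_
      have hcl : closure (QuadCone.posSide (QuadCone.polyFun ρ) Ω) ⊆ {z | 0 ≤ B z z} := by
        rw [hP]
        exact closure_minimal (fun z hz => hz.2.le) (isClosed_le continuous_const hcont)
      exact hcl (hz hzA)
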